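/- Let $u:[0,\infty)\to\mathbb R\cup\{-\infty\}$ be strictly increasing, finite and three times differentiable on $(0,\infty)$, with $u'>0$, $u''<0$, $u'''>0$ there, $\lim_{x\downarrow 0}u'(x)=\infty$ and $\lim_{x\to\infty}u'(x)=0$. Say that $u$ is CRRA if there are $\gamma>0$ and $A>0$ with $u'(x)=A x^{-\gamma}$ for all $x>0$. (a) Necessity. For a random vector $(\beta,R,Y)$ with strictly positive components and finite support, the one-period consumption function $c(w)$, $w>0$, is the solution of $$\max_{c}\; u(c)+\mathrm E[\beta\,u(R(w-c)+Y)]\quad\text{subject to } c\ge 0 \text{ and } R(w-c)+Y\ge 0 \text{ in every state.}$$ If this consumption function is concave on $(0,\infty)$ for every such distribution of $(\beta,R,Y)$, then $u$ is CRRA. (b) Sufficiency. Let $u$ be CRRA. Let $(\Omega,\mathcal F,(\mathcal F_t)_{t\ge 0},P)$ be any filtered probability space, $T\ge 0$, and let $\beta_t>0$, $R_t>0$, $Y_t\ge 0$ ($1\le t\le T$) be adapted processes. For $0\le t\le T$ and a wealth level $w\ge0$ consider the problem $$\max\; \mathrm E\Big[\sum_{s=t}^T\Big(\prod_{r=t+1}^s\beta_r\Big)u(c_s)\,\Big|\,\mathcal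 F_t\Big]$$ over adapted plans $c_s>0$ ($t\le s\le T$) with $w_t=w$, $w_{s+1}=R_{s+1}(w_s-c_s)+Y_{s+1}\ge 0$ for $t\le s<T$, and $c_T\le w_T$; a solution is a plan whose conditional expected utility is almost surely finite and almost surely at least that of every other feasible plan (with $\infty-\infty=-\infty$ in the conditional expectation). Then the time-$t$ consumption function is concave: if $D\subseteq[0,\infty)$ is convex and for every $w\in D$ the problem has a solution, with time-$t$ consumption $c_t(w)$ (an $\mathcal F_t$-measurable random variable), then $w\mapsto c_t(w)$ has a version all of whose paths are concave on $D$. -/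

import Mathlib

open Set Filter Topology MeasureTheory

noncomputable section

namespace ConsumptionSaving

/-! ### Utility functions -/

/-- The real-valued restriction of a utility function `u : [0, ∞) → ℝ ∪ {-∞}` to `(0, ∞)`, where
`u` is finite.  (Utility functions are total functions `ℝ → EReal`; their values at negative
arguments are never used.) -/
def felicity (u : ℝ → EReal) (x : ℝ) : ℝ := (u x).toReal

/-- The standing assumptions on the utility function `u : [0, ∞) → ℝ ∪ {-∞}`: it is finite on
`(0, ∞)`, strictly increasing on `[0, ∞)` (so `u 0 < ∞`, and `u 0 = -∞` is allowed), three times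
differentiable on `(0, ∞)` with `u' > 0`, `u'' < 0`, `u''' > 0`, and satisfies
`u'(0+) = ∞` and `u'(∞) = 0`. -/
structure IsRegularUtility (u : ℝ → EReal) : Prop where
  finite : ∀ x, 0 < x → u x ≠ ⊥ ∧ u x ≠ ⊤
  strictMonoOn : StrictMonoOn u (Ici 0)
  diff₁ : ∀ x, 0 < x → DifferentiableAt ℝ (felicity u) x
  diff₂ : ∀ x, 0 < x → DifferentiableAt ℝ (deriv (felicity u)) x
  diff₃ : ∀ x, 0 < x → DifferentiableAt ℝ (deriv (deriv (felicity u))) x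
  deriv_pos : ∀ x, 0 < x → 0 < deriv (felicity u) x
  deriv₂_neg : ∀ x, 0 < x → deriv (deriv (felicity u)) x < 0
  deriv₃_pos : ∀ x, 0 < x → 0 < deriv (deriv (deriv (felicity u))) x
  inada_zero : Tendsto (deriv (felicity u)) (𝓝[>] 0) atTop
  inada_top : Tendsto (deriv (felicity u)) atTop (𝓝 0)

/-- Constant relative risk aversion: `u'(x) = A x ^ (-γ)` on `(0, ∞)` for some `γ > 0` and some
multiplicative constant `A > 0`. -/
def IsCRRA (u : ℝ → EReal) : Prop :=
  ∃ γ : ℝ, 0 < γ ∧ ∃ A : ℝ, 0 < A ∧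
    ∀ x : ℝ, 0 < x → HasDerivAt (felicity u) (A * x ^ (-γ)) x

/-! ### The one-period problem -/

/-- A strictly positive random vector `(β, R, Y)` with finite support, described by its values
`(β n, R n, Y n)` and their probabilities `π n`, `n = 1, …, N`. -/
structure IsFiniteDistribution {N : ℕ} (π β R Y : Fin N → ℝ) : Prop where
  prob_pos : ∀ n, 0 < π n
  prob_sum : ∑ n, π n = 1
  β_pos : ∀ n, 0 < β n
  R_pos : ∀ n, 0 < R n
  Y_pos : ∀ n, 0 < Y n

/-- The objective `u(c) + E[β u(R(w - c) + Y)]` of the one-period problem. -/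
def staticObjective (u : ℝ → EReal) {N : ℕ} (π β R Y : Fin N → ℝ) (w c : ℝ) : EReal :=
  u c + ∑ n, ((π n * β n : ℝ) : EReal) * u (R n * (w - c) + Y n)

/-- The feasible consumption levels: `c ≥ 0`, and `R(w - c) + Y ≥ 0` in every state. -/
def staticFeasible {N : ℕ} (R Y : Fin N → ℝ) (w : ℝ) : Set ℝ :=
  {c | 0 ≤ c ∧ ∀ n, 0 ≤ R n * (w - c) + Y n}

/-- `c` is the consumption function of the one-period problem: for every initial wealth `w > 0`,
the consumption `c w` is a solution. -/
def IsStaticConsumptionFunction (u : ℝ → EReal) {N : ℕ} (π β R Y : Fin N → ℝ)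
    (c : ℝ → ℝ) : Prop :=
  ∀ w, 0 < w → c w ∈ staticFeasible R Y w ∧
    IsMaxOn (staticObjective u π β R Y w) (staticFeasible R Y w) (c w)

/-! ### The general finite-horizon problem -/

section Dynamic

variable {Ω : Type*} {m : MeasurableSpace Ω}

/-- The stochastic environment up to the horizon `T`: discount factors `β t > 0`, gross returns
`R t > 0` and incomes `Y t ≥ 0` (`t = 1, …, T`), observed at time `t`. -/
structure IsEnvironment (P : Measure Ω) (ℱ : Filtration ℕ m) (T : ℕ) (β R Y : ℕ → Ω → ℝ) :
    Prop where
  β_meas : ∀ t, 1 ≤ t → t ≤ T → Measurable[ℱ t] (β t)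
  R_meas : ∀ t, 1 ≤ t → t ≤ T → Measurable[ℱ t] (R t)
  Y_meas : ∀ t, 1 ≤ t → t ≤ T → Measurable[ℱ t] (Y t)
  β_pos : ∀ t, 1 ≤ t → t ≤ T → ∀ᵐ ω ∂P, 0 < β t ω
  R_pos : ∀ t, 1 ≤ t → t ≤ T → ∀ᵐ ω ∂P, 0 < R t ω
  Y_nonneg : ∀ t, 1 ≤ t → t ≤ T → ∀ᵐ ω ∂P, 0 ≤ Y t ω

/-- Financial wealth at the beginning of time `t + k` when wealth at time `t` is `w` and the
consumption plan is `C`:  `w_{s+1} = R_{s+1} (w_s - c_s) + Y_{s+1}`. -/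
def wealth (R Y C : ℕ → Ω → ℝ) (t : ℕ) (w : ℝ) : ℕ → Ω → ℝ
  | 0 => fun _ => w
  | k + 1 => fun ω =>
      R (t + k + 1) ω * (wealth R Y C t w k ω - C (t + k) ω) + Y (t + k + 1) ω

/-- `C` is a feasible consumption plan from time `t` on, given wealth `w` at time `t`: it is
adapted, consumption is positive, wealth satisfies `w_{s+1} ≥ 0`, and the agent does not die in
debt (`c_T ≤ w_T`). -/
structure IsFeasiblePlan (P : Measure Ω) (ℱ : Filtration ℕ m) (T : ℕ) (R Y : ℕ → Ω → ℝ)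
    (t : ℕ) (w : ℝ) (C : ℕ → Ω → ℝ) : Prop where
  adapted : ∀ s, t ≤ s → s ≤ T → Measurable[ℱ s] (C s)
  pos : ∀ s, t ≤ s → s ≤ T → ∀ᵐ ω ∂P, 0 < C s ω
  wealth_nonneg : ∀ k, t + k + 1 ≤ T → ∀ᵐ ω ∂P, 0 ≤ wealth R Y C t w (k + 1) ω
  terminal : ∀ᵐ ω ∂P, C T ω ≤ wealth R Y C t w (T - t) ω

/-- Realized lifetime utility from time `t` on, discounted to time `t`:
`∑_{s = t}^T (∏_{r = t+1}^s β_r) u(c_s)`. -/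
def lifetimeUtility (u : ℝ → EReal) (T : ℕ) (β : ℕ → Ω → ℝ) (t : ℕ) (C : ℕ → Ω → ℝ) (ω : Ω) : ℝ :=
  ∑ s ∈ Finset.Icc t T, (∏ r ∈ Finset.Ioc t s, β r ω) * felicity u (C s ω)

/-- The extended-real conditional expectation `E[X | 𝒢] = E[X⁺ | 𝒢] - E[X⁻ | 𝒢]`, with the
convention `∞ - ∞ = -∞`. -/
def extCondExp (P : Measure Ω) (𝒢 : MeasurableSpace Ω) (X : Ω → ℝ) (ω : Ω) : EReal :=
  (condLExp 𝒢 P (fun ω' => ENNReal.ofReal (X ω')) ω : EReal) -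
    (condLExp 𝒢 P (fun ω' => ENNReal.ofReal (-X ω')) ω : EReal)

/-- `C` solves the consumption-saving problem from time `t` on, given wealth `w` at time `t`: it is
feasible, its conditional expected lifetime utility is finite, and no feasible plan has a larger
conditional expected lifetime utility. -/
structure IsOptimalPlan (u : ℝ → EReal) (P : Measure Ω) (ℱ : Filtration ℕ m) (T : ℕ)
    (β R Y : ℕ → Ω → ℝ) (t : ℕ) (w : ℝ) (C : ℕ → Ω → ℝ) : Prop where
  feasible : IsFeasiblePlan P ℱ T R Y t w C
  finite : ∀ᵐ ω ∂P, extCondExp P (ℱ t) (lifetimeUtility u T β t C) ω ≠ ⊥ ∧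
    extCondExp P (ℱ t) (lifetimeUtility u T β t C) ω ≠ ⊤
  optimal : ∀ C', IsFeasiblePlan P ℱ T R Y t w C' →
    ∀ᵐ ω ∂P, extCondExp P (ℱ t) (lifetimeUtility u T β t C') ω ≤
      extCondExp P (ℱ t) (lifetimeUtility u T β t C) ω

/-- `c` is a time-`t` consumption function on the set `D` of wealth levels: for every `w ∈ D` the
problem from time `t` on with current wealth `w` has a solution whose time-`t` consumption is
`c w` (a random variable, since it depends on the information available at time `t`). -/
def IsConsumptionFunction (u : ℝ → EReal) (P : Measure Ω) (ℱ : Filtration ℕ m) (T : ℕ)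
    (β R Y : ℕ → Ω → ℝ) (t : ℕ) (D : Set ℝ) (c : ℝ → Ω → ℝ) : Prop :=
  ∀ w ∈ D, ∃ C, IsOptimalPlan u P ℱ T β R Y t w C ∧ C t =ᵐ[P] c w

/-- The random function `c`, each of whose values `c w` is determined up to null events, is concave
on `D`: it has a version all of whose paths are concave on `D`. -/
def HasConcaveVersion (P : Measure Ω) (D : Set ℝ) (c : ℝ → Ω → ℝ) : Prop :=
  ∃ c' : ℝ → Ω → ℝ, (∀ w ∈ D, c' w =ᵐ[P] c w) ∧ ∀ ω, ConcaveOn ℝ D (fun w => c' w ω)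

end Dynamic

end ConsumptionSaving

end

/-! Necessity needs only one state and gross return 1. Write v = u', and let x = w + y - c be what
is left for tomorrow. The interior Euler equation v(c) = q v(x) determines consumption, and c' = q
v'(x) / (v'(c) + q v'(x)). If c is concave, then v'(c) / v'(x) is nondecreasing in w. Its derivative
at a wealth where c = a, x = b and q = v(a) / v(b) gives K(a) ≤ K(b) for the curvature K = v v'' /
v'² (`curvature_le`). Since a and b are arbitrary, K is a constant k, so -v/v' is affine with slope
k - 1. The Inada condition at 0 removes the intercept, and v is a power (`isCRRA_of_curvature`).

Sufficiency avoids value functions and works with M_s(C) = (∏β)(∏R) c_s^(-γ), the `marginalValue` of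
a plan. Three facts carry it. (1) Saving more is always feasible, so M(C) is a supermartingale for
an optimal C (`setLIntegral_marginalValue_succ_le`). (2) On events where C is strictly richer after
consuming than another feasible plan C', some of that excess can be consumed now, and M_s(C) ≤
E[M_{s+1}(C) | ℱ_s] (`setLIntegral_marginalValue_le_succ`). (3) The mixture C' = a C₀ + b C₁ of
optimal plans inherits (1), because the power mean with exponent -γ is concave and homogeneous
(`setLIntegral_marginalValue_mixPlan_succ_le`). This is where CRRA is essential.

Let C be optimal from the mixed wealth. Backward induction shows that C' consumes no more than C
wherever C' is not richer (`mixPlan_le`). If C is strictly richer after consuming, then M_s(C) ≤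
E[M_{s+1}(C) | ℱ_s] ≤ E[M_{s+1}(C') | ℱ_s] ≤ M_s(C'), the middle step being the induction
hypothesis. Otherwise the budget identity gives the claim. At time t wealths agree, which yields the
three-point concavity inequality almost surely for each triple. Finally `hasConcaveVersion_of_ae`
passes to a version through a concave hull over a countable set. -/

noncomputable section

namespace ConsumptionSaving

/-! ### Necessity of constant relative risk aversion -/

/-- A differentiable function with antitone derivative lies below its tangents. -/
theorem le_tangent_of_antitoneOn_deriv {f v : ℝ → ℝ} (hf : ∀ x, 0 < x → HasDerivAt f (v x) x)
    (hv : AntitoneOn v (Ioi 0)) {x y : ℝ} (hx : 0 < x) (hy : 0 < y) :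
    f y ≤ f x + v x * (y - x) := by
  rcases lt_trichotomy x y with h | h | h
  · obtain ⟨z, hz, he⟩ := exists_hasDerivAt_eq_slope f v h
      (fun z hz => (hf z (hx.trans_le hz.1)).continuousAt.continuousWithinAt)
      (fun z hz => hf z (hx.trans hz.1))
    have hvz : v z ≤ v x := hv hx (hx.trans hz.1) hz.1.le
    rw [he, div_le_iff₀ (by linarith)] at hvz
    linarith
  · simp [h]
  · obtain ⟨z, hz, he⟩ := exists_hasDerivAt_eq_slope f v h
      (fun z hz => (hf z (hy.trans_le hz.1)).continuousAt.continuousWithinAt)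
      (fun z hz => hf z (hy.trans hz.1))
    have hvz : v x ≤ v z := hv (hy.trans hz.1) hx hz.2.le
    rw [he, le_div_iff₀ (by linarith)] at hvz
    linarith

/-! ### Tangent bounds and the Euler equation of the one-state problem. -/

namespace IsRegularUtility

variable {u : ℝ → EReal}

theorem strictAntiOn_deriv (hu : IsRegularUtility u) : StrictAntiOn (deriv (felicity u)) (Ioi 0) :=
  strictAntiOn_of_deriv_neg (convex_Ioi 0)
    (fun x hx => (hu.diff₂ x hx).continuousAt.continuousWithinAt)
    (fun x hx => hu.deriv₂_neg x (by simpa using hx))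

theorem coe_felicity (hu : IsRegularUtility u) {x : ℝ} (hx : 0 < x) : ((felicity u x : ℝ) : EReal) = u x :=
  EReal.coe_toReal (hu.finite x hx).2 (hu.finite x hx).1

theorem felicity_le_tangent (hu : IsRegularUtility u) {x y : ℝ} (hx : 0 < x) (hy : 0 < y) :
    felicity u y ≤ felicity u x + deriv (felicity u) x * (y - x) :=
  le_tangent_of_antitoneOn_deriv (fun x hx => (hu.diff₁ x hx).hasDerivAt)
    hu.strictAntiOn_deriv.antitoneOn hx hy

/-- The tangent inequality, up to the boundary point `0` of the domain. -/
theorem le_tangent (hu : IsRegularUtility u) {x y : ℝ} (hx : 0 < x) (hy : 0 ≤ y) :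
    u y ≤ ((felicity u x + deriv (felicity u) x * (y - x) : ℝ) : EReal) := by
  rcases hy.eq_or_lt with rfl | hy
  -- At 0 only monotonicity is available: u 0 ≤ u y for y > 0, and the tangent bound at y passes to
  -- the limit y ↓ 0.
  · have hlim : Tendsto (fun y : ℝ => ((felicity u x + deriv (felicity u) x * (y - x) : ℝ) : EReal))
        (𝓝[>] 0) (𝓝 ((felicity u x + deriv (felicity u) x * (0 - x) : ℝ) : EReal)) := by
      refine Tendsto.mono_left ?_ nhdsWithin_le_nhds
      exact (continuous_coe_real_ereal.comp (by fun_prop)).tendsto 0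
    refine ge_of_tendsto hlim ?_
    filter_upwards [self_mem_nhdsWithin] with y hy
    have hy : 0 < y := hy
    refine (hu.strictMonoOn (mem_Ici.2 le_rfl) (mem_Ici.2 hy.le) hy).le.trans ?_
    rw [← hu.coe_felicity hy]
    exact_mod_cast hu.felicity_le_tangent hx hy
  · rw [← hu.coe_felicity hy]
    exact_mod_cast hu.felicity_le_tangent hx hy

/-- The Euler equation of the one-state problem has an interior solution. -/
theorem exists_euler (hu : IsRegularUtility u) {q z : ℝ} (hq : 0 < q) (hz : 0 < z) :
    ∃ c, 0 < c ∧ c < z ∧ deriv (felicity u) c = q * deriv (felicity u) (z - c) := by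
  set v := deriv (felicity u) with hv
  have hvc : ∀ x, 0 < x → ContinuousAt v x := fun x hx => (hu.diff₂ x hx).continuousAt
  have hzero : Tendsto v (𝓝[>] 0) atTop := hu.inada_zero
  have hhalf : ∀ p : ℝ, ∃ a, 0 < a ∧ a < z / 2 ∧ p < v a := by
    intro p
    have h1 := hzero.eventually (eventually_gt_atTop p)
    have h2 : ∀ᶠ a in 𝓝[>] (0 : ℝ), a ∈ Ioo 0 (z / 2) := Ioo_mem_nhdsGT (by linarith)
    obtain ⟨a, ha, hb⟩ := (h1.and h2).exists
    exact ⟨a, hb.1, hb.2, ha⟩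
  -- By the Inada condition at 0, the Euler difference is positive at a and negative at z - b; the
  -- intermediate value theorem then applies.
  obtain ⟨a, ha, haz, hva⟩ := hhalf (q * v (z / 2))
  obtain ⟨b, hb, hbz, hvb⟩ := hhalf (v (z / 2) / q)
  rw [div_lt_iff₀ hq] at hvb
  have hanti := hu.strictAntiOn_deriv
  have h0 : ContinuousOn (fun c => v c - q * v (z - c)) (Icc a (z - b)) := by
    intro c hc
    refine ContinuousAt.continuousWithinAt ?_
    refine (hvc c (by linarith [hc.1])).sub (continuousAt_const.mul ?_)
    have : ContinuousAt v (z - c) := hvc _ (by linarith [hc.2])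
    exact ContinuousAt.comp (f := fun c => z - c) (by simpa using this) (by fun_prop)
  have hmem : (0 : ℝ) ∈ Icc (v (z - b) - q * v (z - (z - b))) (v a - q * v (z - a)) := by
    constructor
    · have : v (z - b) < v (z / 2) :=
        hanti (mem_Ioi.2 (by linarith)) (mem_Ioi.2 (by linarith)) (by linarith)
      rw [sub_sub_cancel]
      linarith [mul_comm q (v b)]
    · have : v (z - a) < v (z / 2) :=
        hanti (mem_Ioi.2 (by linarith)) (mem_Ioi.2 (by linarith)) (by linarith)
      have := mul_lt_mul_of_pos_left this hq
      linarith
  obtain ⟨c, hc, hce⟩ := intermediate_value_Icc' (by linarith) h0 hmem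
  exact ⟨c, by linarith [hc.1], by linarith [hc.2], by linarith [hce]⟩

/-- In the one-state problem with gross return `1`, a solution of the Euler equation is optimal. -/
theorem isMaxOn_of_euler (hu : IsRegularUtility u) {q y w c : ℝ} (hq : 0 < q) (hc : 0 < c) (hcw : c < w + y)
    (he : deriv (felicity u) c = q * deriv (felicity u) (w + y - c)) :
    IsMaxOn (staticObjective u (fun _ : Fin 1 => 1) (fun _ => q) (fun _ => 1) (fun _ => y) w)
      (staticFeasible (fun _ : Fin 1 => 1) (fun _ => y) w) c := by
  have hx : 0 < w + y - c := by linarith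
  intro c' hc'
  have hc0 : 0 ≤ c' := hc'.1
  have hx0 : 0 ≤ w + y - c' := by have := hc'.2 0; linarith
  have e : ∀ d : ℝ, w - d + y = w + y - d := fun d => by ring
  simp only [mem_ofPred_eq, staticObjective, Finset.univ_unique, Finset.sum_singleton, one_mul, e]
  have h1 := hu.le_tangent hc hc0
  have h2 := mul_le_mul_of_nonneg_left (hu.le_tangent hx hx0)
    (show (0 : EReal) ≤ ((q : ℝ) : EReal) by exact_mod_cast hq.le)
  refine (add_le_add h1 h2).trans ?_
  rw [← hu.coe_felicity hc, ← hu.coe_felicity hx]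
  norm_cast
  rw [he]
  apply le_of_eq
  ring

end IsRegularUtility

theorem div_le_div_iff_of_neg_of_neg {a b c d : ℝ} (hb : b < 0) (hd : d < 0) :
    a / b ≤ c / d ↔ a * d ≤ c * b := by
  rw [← neg_div_neg_eq a b, ← neg_div_neg_eq c d, div_le_div_iff₀ (by linarith) (by linarith)]
  simp

/-! ### From concave consumption to constant curvature, and from there to power marginal utility. -/

namespace IsRegularUtility

variable {u : ℝ → EReal}

/-- The marginal propensity to consume, by implicit differentiation of the Euler equation. -/
theorem hasDerivAt_of_euler (hu : IsRegularUtility u) {q y : ℝ} (hq : 0 < q) {c : ℝ → ℝ}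
    (hc : ∀ w, 0 < w → 0 < c w ∧ c w < w + y ∧
      deriv (felicity u) (c w) = q * deriv (felicity u) (w + y - c w))
    (hcont : ContinuousOn c (Ioi 0)) {w₀ : ℝ} (hw₀ : 0 < w₀) :
    HasDerivAt c (q * deriv (deriv (felicity u)) (w₀ + y - c w₀) /
      (deriv (deriv (felicity u)) (c w₀) + q * deriv (deriv (felicity u)) (w₀ + y - c w₀))) w₀ := by
  set v := deriv (felicity u) with hv
  obtain ⟨h1, h2, h3⟩ := hc w₀ hw₀
  have hx₀ : 0 < w₀ + y - c w₀ := by linarith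
  have hca : ContinuousAt c w₀ := hcont.continuousAt (Ioi_mem_nhds hw₀)
  -- With `dslope`, subtracting the Euler equations at w and w₀ gives an identity linear in c w - c
  -- w₀ that remains valid when c w = c w₀. The limits of the coefficients need only continuity of
  -- c.
  have hm1 : Tendsto (fun w => dslope v (c w₀) (c w)) (𝓝 w₀) (𝓝 (deriv v (c w₀))) := by
    have := (continuousAt_dslope_same.2 (hu.diff₂ _ h1)).tendsto.comp hca.tendsto
    rwa [dslope_same] at this
  have hm2 : Tendsto (fun w => dslope v (w₀ + y - c w₀) (w + y - c w)) (𝓝 w₀)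
      (𝓝 (deriv v (w₀ + y - c w₀))) := by
    have hx : Tendsto (fun w => w + y - c w) (𝓝 w₀) (𝓝 (w₀ + y - c w₀)) :=
      ((continuousAt_id.add continuousAt_const).sub hca).tendsto
    have := (continuousAt_dslope_same.2 (hu.diff₂ _ hx₀)).tendsto.comp hx
    rwa [dslope_same] at this
  have hden : deriv v (c w₀) + q * deriv v (w₀ + y - c w₀) < 0 := by
    have := mul_neg_of_pos_of_neg hq (hu.deriv₂_neg _ hx₀)
    linarith [hu.deriv₂_neg _ h1]
  have hsum := hm1.add (hm2.const_mul q)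
  rw [hasDerivAt_iff_tendsto_slope]
  refine (((hm2.const_mul q).div hsum hden.ne).mono_left nhdsWithin_le_nhds).congr' ?_
  have hne : ∀ᶠ w in 𝓝[≠] w₀, dslope v (c w₀) (c w) +
      q * dslope v (w₀ + y - c w₀) (w + y - c w) ≠ 0 :=
    (hsum.mono_left nhdsWithin_le_nhds).eventually_ne hden.ne
  filter_upwards [hne, self_mem_nhdsWithin, mem_nhdsWithin_of_mem_nhds (Ioi_mem_nhds hw₀)]
    with w hw hww hw0
  have hww' : w - w₀ ≠ 0 := sub_ne_zero.2 hww
  have e1 := sub_smul_dslope v (c w₀) (c w)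
  have e2 := sub_smul_dslope v (w₀ + y - c w₀) (w + y - c w)
  simp only [smul_eq_mul] at e1 e2
  rw [slope_def_field, Pi.div_apply, div_eq_div_iff hw hww']
  have h3' := (hc w hw0).2.2
  linear_combination q * e2 - e1 - h3' + h3

/-- Concavity of the consumption function of a one-state problem compares the curvature
`v v'' / v'²` of the marginal utility `v` at consumption today and tomorrow. -/
theorem curvature_le (hu : IsRegularUtility u)
    (h : ∀ (N : ℕ) (π β R Y : Fin N → ℝ), IsFiniteDistribution π β R Y →
        ∀ c : ℝ → ℝ, IsStaticConsumptionFunction u π β R Y c → ConcaveOn ℝ (Ioi 0) c)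
    {a b : ℝ} (ha : 0 < a) (hb : 0 < b) :
    deriv (felicity u) a * deriv (deriv (deriv (felicity u))) a *
        deriv (deriv (felicity u)) b ^ 2 ≤
      deriv (felicity u) b * deriv (deriv (deriv (felicity u))) b *
        deriv (deriv (felicity u)) a ^ 2 := by
  set v := deriv (felicity u) with hv
  have hva : 0 < v a := hu.deriv_pos a ha
  have hvb : 0 < v b := hu.deriv_pos b hb
  have hq : 0 < v a / v b := div_pos hva hvb
  set q := v a / v b with hqdef
  -- Income b/2 and wealth a + b/2 are both positive and add up to a + b, so consuming a leaves
  -- exactly b.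
  have hex : ∀ w : ℝ, ∃ c, 0 < w → 0 < c ∧ c < w + b / 2 ∧ v c = q * v (w + b / 2 - c) := by
    intro w
    by_cases hw : 0 < w
    · obtain ⟨c, hc⟩ := hu.exists_euler hq (show 0 < w + b / 2 by linarith)
      exact ⟨c, fun _ => hc⟩
    · exact ⟨0, fun h => absurd h hw⟩
  choose c hc using hex
  have hconc : ConcaveOn ℝ (Ioi 0) c := by
    refine h 1 (fun _ => 1) (fun _ => q) (fun _ => 1) (fun _ => b / 2)
      ⟨by simp, by simp, fun _ => hq, by simp, fun _ => by simpa using hb⟩ c fun w hw => ?_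
    obtain ⟨h1, h2, h3⟩ := hc w hw
    refine ⟨⟨h1.le, fun _ => ?_⟩, hu.isMaxOn_of_euler hq h1 h2 h3⟩
    linarith
  have hcont := hconc.continuousOn isOpen_Ioi
  have hder := fun w (hw : 0 < w) => hu.hasDerivAt_of_euler hq hc hcont hw
  rw [← hv] at hder
  have hx : ∀ w, 0 < w → 0 < w + b / 2 - c w := fun w hw => by linarith [(hc w hw).2.1]
  have hw₀ : 0 < a + b / 2 := by linarith
  have hca : c (a + b / 2) = a := by
    obtain ⟨h1, h2, h3⟩ := hc _ hw₀
    have hanti := hu.strictAntiOn_deriv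
    have hab : v a = q * v b := by rw [hqdef]; field_simp
    rcases lt_trichotomy (c (a + b / 2)) a with hlt | heq | hgt
    · have i1 := hanti (mem_Ioi.2 h1) (mem_Ioi.2 ha) hlt
      have i2 := hanti (mem_Ioi.2 hb) (mem_Ioi.2 (hx _ hw₀)) (by linarith)
      have := mul_lt_mul_of_pos_left i2 hq
      rw [← hv] at i1 this
      linarith
    · exact heq
    · have i1 := hanti (mem_Ioi.2 ha) (mem_Ioi.2 h1) hgt
      have i2 := hanti (mem_Ioi.2 (hx _ hw₀)) (mem_Ioi.2 hb) (by linarith)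
      have := mul_lt_mul_of_pos_left i2 hq
      rw [← hv] at i1 this
      linarith
  have hxb : a + b / 2 + b / 2 - c (a + b / 2) = b := by rw [hca]; ring
  have hd1 : ∀ w, 0 < w → deriv v (c w) < 0 := fun w hw => hu.deriv₂_neg _ (hc w hw).1
  have hd2 : ∀ w, 0 < w → deriv v (w + b / 2 - c w) < 0 := fun w hw => hu.deriv₂_neg _ (hx w hw)
  -- The derivative of c equals 1 / (1 + ratio / q), so it decreases exactly when the ratio
  -- increases.
  have hmono : MonotoneOn (fun w => deriv v (c w) / deriv v (w + b / 2 - c w)) (Ioi 0) := by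
    intro w₁ h₁ w₂ h₂ h₁₂
    have hanti := hconc.antitoneOn_deriv (fun x hx => (hder x hx).differentiableAt) h₁ h₂ h₁₂
    rw [(hder w₁ h₁).deriv, (hder w₂ h₂).deriv] at hanti
    have n1 := hd1 w₁ h₁
    have n2 := hd1 w₂ h₂
    have m1 := hd2 w₁ h₁
    have m2 := hd2 w₂ h₂
    have s1 := mul_neg_of_pos_of_neg hq m1
    have s2 := mul_neg_of_pos_of_neg hq m2
    rw [div_le_div_iff_of_neg_of_neg (by linarith) (by linarith)] at hanti
    show _ / _ ≤ _ / _
    rw [div_le_div_iff_of_neg_of_neg m1 m2]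
    have : q * (deriv v (c w₁) * deriv v (w₂ + b / 2 - c w₂)) ≤
      q * (deriv v (c w₂) * deriv v (w₁ + b / 2 - c w₁)) := by nlinarith
    exact le_of_mul_le_mul_left this hq
  have hD := hder _ hw₀
  rw [hxb, hca] at hD
  set D := q * deriv v b / (deriv v a + q * deriv v b) with hDdef
  have g1 : HasDerivAt (fun w => deriv v (c w)) (deriv (deriv v) a * D) (a + b / 2) :=
    HasDerivAt.comp (h₂ := deriv v) (a + b / 2) (by rw [hca]; exact (hu.diff₃ _ ha).hasDerivAt) hD
  have g2 : HasDerivAt (fun w => deriv v (w + b / 2 - c w)) (deriv (deriv v) b * (1 - D))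
      (a + b / 2) :=
    HasDerivAt.comp (h₂ := deriv v) (h := fun w => w + b / 2 - c w) (a + b / 2)
      (by simp only [hxb]; exact (hu.diff₃ _ hb).hasDerivAt)
      (((hasDerivAt_id _).add_const (b / 2)).sub hD)
  have hK := g1.div g2 (hd2 _ hw₀).ne
  have hnn := hmono.derivWithin_nonneg (x := a + b / 2)
  have hnn :=
    hnn.trans_eq (hK.hasDerivWithinAt.derivWithin (isOpen_Ioi.uniqueDiffWithinAt hw₀))
  rw [hxb, hca, hDdef] at hnn
  have na : deriv v a < 0 := hu.deriv₂_neg _ ha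
  have nb : deriv v b < 0 := hu.deriv₂_neg _ hb
  set a' := deriv v a
  set b' := deriv v b
  set a'' := deriv (deriv v) a
  set b'' := deriv (deriv v) b
  have hs : a' + q * b' < 0 := by linarith [mul_neg_of_pos_of_neg hq nb]
  have h4 : 0 ≤ a'' * (q * b' / (a' + q * b')) * b' -
      a' * (b'' * (1 - q * b' / (a' + q * b'))) := by
    have := mul_nonneg hnn (sq_nonneg b')
    rwa [div_mul_cancel₀ _ (pow_ne_zero 2 nb.ne)] at this
  have h5 : a'' * (q * b' / (a' + q * b')) * b' -
      a' * (b'' * (1 - q * b' / (a' + q * b'))) = (q * a'' * b' ^ 2 - b'' * a' ^ 2) / (a' + q * b') := by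
    have := hs.ne
    field_simp
    ring
  rw [h5, div_nonneg_iff] at h4
  have h6 : q * a'' * b' ^ 2 ≤ b'' * a' ^ 2 := by
    rcases h4 with h4 | h4
    · linarith [h4.2]
    · linarith [h4.1]
  have h7 := mul_le_mul_of_nonneg_left h6 hvb.le
  have h8 : v b * (q * a'' * b' ^ 2) = v a * a'' * b' ^ 2 := by
    rw [hqdef]; field_simp
  linarith

/-- A marginal utility with constant curvature `v v'' / v'²` is a power function. -/
theorem isCRRA_of_curvature (hu : IsRegularUtility u)
    (h : ∀ a b : ℝ, 0 < a → 0 < b →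
      deriv (felicity u) a * deriv (deriv (deriv (felicity u))) a *
        deriv (deriv (felicity u)) b ^ 2 =
      deriv (felicity u) b * deriv (deriv (deriv (felicity u))) b *
        deriv (deriv (felicity u)) a ^ 2) : IsCRRA u := by
  set v := deriv (felicity u) with hv
  have hpos : ∀ x, 0 < x → 0 < v x := hu.deriv_pos
  have hneg : ∀ x, 0 < x → deriv v x < 0 := hu.deriv₂_neg
  have hd : ∀ x, 0 < x → HasDerivAt v (deriv v x) x := fun x hx => (hu.diff₂ x hx).hasDerivAt
  have hd' : ∀ x, 0 < x → HasDerivAt (deriv v) (deriv (deriv v) x) x :=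
    fun x hx => (hu.diff₃ x hx).hasDerivAt
  obtain ⟨k, hk⟩ : ∃ k, ∀ x, 0 < x → v x * deriv (deriv v) x = k * deriv v x ^ 2 := by
    refine ⟨v 1 * deriv (deriv v) 1 / deriv v 1 ^ 2, fun x hx => ?_⟩
    have := h x 1 hx one_pos
    have h1 := (hneg 1 one_pos).ne
    field_simp
    linarith
  have hline : ∃ b, ∀ x, 0 < x → - (v x / deriv v x) = (k - 1) * x + b := by
    -- By the quotient rule the derivative of -v/v' is v v''/v'² - 1 = k - 1.
    have hg : ∀ x, 0 < x → HasDerivAt (fun x => - (v x / deriv v x) - (k - 1) * x) 0 x := by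
      intro x hx
      have h0 := (hneg x hx).ne
      have := (((hd x hx).div (hd' x hx) h0).neg).sub ((hasDerivAt_id x).const_mul (k - 1))
      refine this.congr_deriv ?_
      rw [hk x hx]
      field_simp
      ring
    refine ⟨- (v 1 / deriv v 1) - (k - 1) * 1, fun x hx => ?_⟩
    have hconst := (convex_Ioi (0 : ℝ)).is_const_of_fderivWithin_eq_zero (𝕜 := ℝ)
      (f := fun x => - (v x / deriv v x) - (k - 1) * x)
      (fun x hx => (hg x hx).differentiableAt.differentiableWithinAt)
      (fun x hx => by
        have := (hg x hx).hasFDerivAt.hasFDerivWithinAt.fderivWithin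
          (isOpen_Ioi.uniqueDiffWithinAt hx)
        rw [this]; ext; simp) (mem_Ioi.2 hx) (mem_Ioi.2 one_pos)
    linarith
  obtain ⟨b, hb⟩ := hline
  have hlpos : ∀ x, 0 < x → 0 < (k - 1) * x + b := fun x hx => by
    rw [← hb x hx, ← div_neg]
    exact div_pos (hpos x hx) (by linarith [hneg x hx])
  have hb0 : 0 ≤ b := by
    have hlim : Tendsto (fun x : ℝ => (k - 1) * x + b) (𝓝[>] 0) (𝓝 ((k - 1) * 0 + b)) :=
      Tendsto.mono_left (Continuous.tendsto (by fun_prop) 0) nhdsWithin_le_nhds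
    rw [mul_zero, zero_add] at hlim
    exact ge_of_tendsto hlim (by filter_upwards [self_mem_nhdsWithin] with x hx using (hlpos x hx).le)
  have hk0 : 0 ≤ k - 1 := by
    by_contra hlt
    push Not at hlt
    -- At this point a line of negative slope would take the value -1.
    have hx : 0 < (b + 1) / (1 - k) := div_pos (by linarith) (by linarith)
    have := hlpos _ hx
    rw [show (k - 1) * ((b + 1) / (1 - k)) = -(b + 1) by
      have : (1 - k) ≠ 0 := by linarith
      field_simp; ring] at this
    linarith
  have hb1 : b = 0 := by
    by_contra hne
    have hbpos : 0 < b := lt_of_le_of_ne hb0 (Ne.symm hne)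
    have hbound : ∀ x, 0 < x → x < 1 → v x ≤ v 1 * Real.exp (1 / b) := by
      -- Here v'/v = -1/((k - 1)x + b) ≥ -1/b. Hence v is bounded near 0 if b > 0, against the Inada
      -- condition.
      have hE : MonotoneOn (fun x => v x * Real.exp (x / b)) (Ioi 0) := by
        have hde : ∀ x, 0 < x → HasDerivAt (fun x => v x * Real.exp (x / b))
            (deriv v x * Real.exp (x / b) + v x * (Real.exp (x / b) * (1 / b))) x := fun x hx =>
          (hd x hx).mul (((hasDerivAt_id x).div_const b).exp)
        refine monotoneOn_of_deriv_nonneg (convex_Ioi 0)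
          (fun x hx => (hde x hx).continuousAt.continuousWithinAt)
          (fun x hx => (hde x (by simpa using hx)).differentiableAt.differentiableWithinAt) ?_
        intro x hx
        have hx : 0 < x := by simpa using hx
        rw [(hde x hx).deriv]
        have h1 := hb x hx
        have h2 := hneg x hx
        have h3 : v x = - deriv v x * ((k - 1) * x + b) := by rw [← h1]; field_simp [h2.ne]
        have h4 : deriv v x + v x * (1 / b) = - deriv v x * ((k - 1) * x) / b := by
          rw [h3]; field_simp; ring
        have h5 : 0 ≤ deriv v x + v x * (1 / b) := by
          rw [h4]
          have : 0 ≤ (k - 1) * x := mul_nonneg hk0 hx.le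
          exact div_nonneg (mul_nonneg (by linarith) this) hbpos.le
        have := mul_nonneg h5 (Real.exp_pos (x / b)).le
        linarith
      intro x hx hx1
      have h1 := hE (mem_Ioi.2 hx) (mem_Ioi.2 one_pos) hx1.le
      have h2 : 1 ≤ Real.exp (x / b) := Real.one_le_exp (div_pos hx hbpos).le
      have h3 := mul_le_mul_of_nonneg_left h2 (hpos x hx).le
      simp only at h1
      linarith
    have h1 := hu.inada_zero.eventually (eventually_gt_atTop (v 1 * Real.exp (1 / b)))
    have h2 : ∀ᶠ x in 𝓝[>] (0 : ℝ), x ∈ Ioo (0 : ℝ) 1 := Ioo_mem_nhdsGT one_pos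
    obtain ⟨x, hx1, hx2⟩ := (h1.and h2).exists
    exact absurd (hbound x hx2.1 hx2.2) (not_le.2 hx1)
  subst hb1
  have hkpos : 0 < k - 1 := by simpa using hlpos 1 one_pos
  refine ⟨1 / (k - 1), one_div_pos.2 hkpos, v 1, hpos 1 one_pos, fun x hx => ?_⟩
  have hg : ∀ x, 0 < x → HasDerivAt (fun x => v x * x ^ (1 / (k - 1))) 0 x := by
    intro x hx
    refine ((hd x hx).mul (Real.hasDerivAt_rpow_const (p := 1 / (k - 1)) (Or.inl hx.ne'))).congr_deriv ?_
    have h1 := hb x hx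
    have h2 := hneg x hx
    have h3 : v x = - deriv v x * ((k - 1) * x) := by
      rw [← add_zero ((k - 1) * x), ← h1]; field_simp [h2.ne]
    rw [h3, Real.rpow_sub_one hx.ne']
    field_simp
    ring
  have hconst := (convex_Ioi (0 : ℝ)).is_const_of_fderivWithin_eq_zero (𝕜 := ℝ)
      (f := fun x => v x * x ^ (1 / (k - 1)))
      (fun x hx => (hg x hx).differentiableAt.differentiableWithinAt)
      (fun x hx => by
        have := (hg x hx).hasFDerivAt.hasFDerivWithinAt.fderivWithin
          (isOpen_Ioi.uniqueDiffWithinAt hx)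
        rw [this]; ext; simp) (mem_Ioi.2 hx) (mem_Ioi.2 one_pos)
  simp only [Real.one_rpow, mul_one] at hconst
  rw [← hconst, mul_assoc, ← Real.rpow_add hx, add_neg_cancel, Real.rpow_zero, mul_one]
  exact (hu.diff₁ x hx).hasDerivAt

/-- If every one-period consumption function is concave, then utility is CRRA. -/
theorem isCRRA_of_concaveOn_consumption (hu : IsRegularUtility u)
    (h : ∀ (N : ℕ) (π β R Y : Fin N → ℝ), IsFiniteDistribution π β R Y →
        ∀ c : ℝ → ℝ, IsStaticConsumptionFunction u π β R Y c → ConcaveOn ℝ (Ioi 0) c) :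
    IsCRRA u :=
  hu.isCRRA_of_curvature fun _ _ ha hb =>
    le_antisymm (hu.curvature_le h ha hb) (hu.curvature_le h hb ha)

end IsRegularUtility

/-! ### Concave extensions and concave versions -/

/-- Three-chord concavity of a function on an arbitrary set of reals. -/
def ChordConcaveOn (S : Set ℝ) (f : ℝ → ℝ) : Prop :=
  ∀ x ∈ S, ∀ y ∈ S, ∀ z ∈ S, x < y → y < z → (z - y) * f x + (y - x) * f z ≤ (z - x) * f y

theorem ChordConcaveOn.mono {S T : Set ℝ} {f : ℝ → ℝ} (hf : ChordConcaveOn T f) (h : S ⊆ T) :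
    ChordConcaveOn S f :=
  fun x hx y hy z hz => hf x (h hx) y (h hy) z (h hz)

/-- The slope is the infimum of the left chord slopes at w. The point r makes that infimum finite
and l makes it one over a nonempty set. -/
theorem ChordConcaveOn.exists_supergradient {S : Set ℝ} {f : ℝ → ℝ} (hf : ChordConcaveOn S f)
    {l w r : ℝ} (hl : l ∈ S) (hw : w ∈ S) (hr : r ∈ S) (hlw : l < w) (hwr : w < r) :
    ∃ a, ∀ x ∈ S, f x ≤ f w + a * (x - w) := by
  set B : Set ℝ := (fun q => (f w - f q) / (w - q)) '' {q ∈ S | q < w} with hB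
  have hlow : ∀ y ∈ S, w < y → ∀ s ∈ B, (f y - f w) / (y - w) ≤ s := by
    rintro y hy hwy _ ⟨q, ⟨hq, hqw⟩, rfl⟩
    simp only
    rw [div_le_div_iff₀ (by linarith) (by linarith)]
    have := hf q hq w hw y hy hqw hwy
    linarith
  have hne : B.Nonempty := ⟨_, l, ⟨hl, hlw⟩, rfl⟩
  have hbdd : BddBelow B := ⟨_, fun s hs => hlow r hr hwr s hs⟩
  refine ⟨sInf B, fun x hx => ?_⟩
  rcases lt_trichotomy x w with h | h | h
  · have h1 : sInf B ≤ (f w - f x) / (w - x) := csInf_le hbdd ⟨x, ⟨hx, h⟩, rfl⟩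
    rw [le_div_iff₀ (by linarith)] at h1
    linarith
  · simp [h]
  · have h1 : (f x - f w) / (x - w) ≤ sInf B := le_csInf hne (hlow x hx h)
    rw [div_le_iff₀ (by linarith)] at h1
    linarith

theorem convex_setOf_le_affine (a b w : ℝ) : Convex ℝ {p : ℝ × ℝ | p.2 ≤ b + a * (p.1 - w)} := by
  intro p hp q hq s t hs ht hst
  have h1 := mul_le_mul_of_nonneg_left (show p.2 ≤ _ from hp) hs
  have h2 := mul_le_mul_of_nonneg_left (show q.2 ≤ _ from hq) ht
  show s * p.2 + t * q.2 ≤ b + a * (s * p.1 + t * q.1 - w)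
  have hs' : s = 1 - t := by linarith
  subst hs'
  linarith

/-- The half-plane strictly on one side of a vertical line, with a half-line added, is convex. -/
theorem convex_halfPlane_union (e b w : ℝ) :
    Convex ℝ {p : ℝ × ℝ | e * w ≤ e * p.1 ∧ (e * p.1 = e * w → p.2 ≤ b)} := by
  intro p hp q hq s t hs ht hst
  obtain ⟨p1, p2⟩ := p
  obtain ⟨q1, q2⟩ := q
  obtain ⟨hp1, hp2⟩ := hp
  obtain ⟨hq1, hq2⟩ := hq
  simp only at hp1 hp2 hq1 hq2
  have hs' : s = 1 - t := by linarith
  have k1 := mul_le_mul_of_nonneg_left hp1 hs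
  have k2 := mul_le_mul_of_nonneg_left hq1 ht
  show e * w ≤ e * (s * p1 + t * q1) ∧ (e * (s * p1 + t * q1) = e * w → s * p2 + t * q2 ≤ b)
  have hsum : s * (e * w) + t * (e * w) = e * w := by rw [← add_mul, hst, one_mul]
  refine ⟨by linarith, fun he => ?_⟩
  rcases hs.eq_or_lt with h0 | hs
  · have ht1 : t = 1 := by linarith
    subst ht1 h0
    have := hq2 (by linarith)
    linarith
  rcases ht.eq_or_lt with h0 | ht
  · have hs1 : s = 1 := by linarith
    subst hs1 h0
    have := hp2 (by linarith)
    linarith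
  have e1 : e * p1 = e * w := by
    have : s * (e * p1) = s * (e * w) := by linarith
    exact mul_left_cancel₀ hs.ne' this
  have e2 : e * q1 = e * w := by
    have : t * (e * q1) = t * (e * w) := by linarith
    exact mul_left_cancel₀ ht.ne' this
  have := mul_le_mul_of_nonneg_left (hp2 e1) hs.le
  have := mul_le_mul_of_nonneg_left (hq2 e2) ht.le
  have : s * b + t * b = b := by rw [← add_mul, hst, one_mul]
  linarith

/-- The convex hull of the graph of `f` on `S`. -/
def graphHull (S : Set ℝ) (f : ℝ → ℝ) : Set (ℝ × ℝ) := convexHull ℝ ((fun x => (x, f x)) '' S)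

/-- The least concave majorant of `f` on `S`. -/
def concaveHull (S : Set ℝ) (f : ℝ → ℝ) (w : ℝ) : ℝ := sSup {z | (w, z) ∈ graphHull S f}

theorem mem_graphHull {S : Set ℝ} {f : ℝ → ℝ} {w : ℝ} (hw : w ∈ S) : (w, f w) ∈ graphHull S f :=
  subset_convexHull ℝ _ ⟨w, hw, rfl⟩

theorem graphHull_mono {S T : Set ℝ} {f : ℝ → ℝ} (h : S ⊆ T) : graphHull S f ⊆ graphHull T f :=
  convexHull_mono (image_mono h)

theorem graphHull_subset {S : Set ℝ} {f : ℝ → ℝ} {K : Set (ℝ × ℝ)} (hK : Convex ℝ K)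
    (h : ∀ x ∈ S, (x, f x) ∈ K) : graphHull S f ⊆ K :=
  convexHull_min (by rintro _ ⟨x, hx, rfl⟩; exact h x hx) hK

/-- At a point with neighbours in S on both sides, a supergradient separates. At an end point of S
there may be none, and a half-plane with a vertical half-line takes its place. -/
theorem ChordConcaveOn.le_of_mem_graphHull {S : Set ℝ} {f : ℝ → ℝ} (hf : ChordConcaveOn S f)
    {w z : ℝ} (hw : w ∈ S) (hz : (w, z) ∈ graphHull S f) : z ≤ f w := by
  by_cases hl : ∃ l ∈ S, l < w
  · by_cases hr : ∃ r ∈ S, w < r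
    · obtain ⟨l, hl, hlw⟩ := hl
      obtain ⟨r, hr, hwr⟩ := hr
      obtain ⟨a, ha⟩ := hf.exists_supergradient hl hw hr hlw hwr
      have : z ≤ f w + a * (w - w) := graphHull_subset (convex_setOf_le_affine a (f w) w) ha hz
      simpa using this
    · push Not at hr
      refine (graphHull_subset (convex_halfPlane_union (-1) (f w) w) (fun x hx => ?_) hz).2 rfl
      refine ⟨by simpa using hr x hx, fun h => ?_⟩
      have : x = w := by simpa using h
      rw [this]
  · push Not at hl
    refine (graphHull_subset (convex_halfPlane_union 1 (f w) w) (fun x hx => ?_) hz).2 rfl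
    refine ⟨by simpa using hl x hx, fun h => ?_⟩
    have : x = w := by simpa using h
    rw [this]

/-- `S` is dense in `D` and contains the end points of `D`. -/
structure IsOrderDenseIn (S D : Set ℝ) : Prop where
  subset : S ⊆ D
  dense : ∀ x ∈ D, ∀ y ∈ D, x < y → ∃ q ∈ S, x < q ∧ q < y
  exists_lt : ∀ w ∈ D, w ∉ S → ∃ l ∈ D, l < w
  exists_gt : ∀ w ∈ D, w ∉ S → ∃ r ∈ D, w < r

/-- The rationals of D suffice in the interior. End points are added because a concave function may
jump there, so that its interior values do not determine it. -/
theorem exists_countable_isOrderDenseIn {D : Set ℝ} (hD : Convex ℝ D) :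
    ∃ S : Set ℝ, S.Countable ∧ IsOrderDenseIn S D := by
  refine ⟨D ∩ (range ((↑) : ℚ → ℝ) ∪ ({w | IsLeast D w} ∪ {w | IsGreatest D w})), ?_, ?_⟩
  · refine Countable.mono inter_subset_right ((countable_range _).union (Countable.union ?_ ?_))
    · exact (show Set.Subsingleton {w | IsLeast D w} from fun a ha b hb => ha.unique hb).countable
    · exact (show Set.Subsingleton {w | IsGreatest D w} from
        fun a ha b hb => ha.unique hb).countable
  · refine ⟨inter_subset_left, fun x hx y hy hxy => ?_, fun w hw hwS => ?_, fun w hw hwS => ?_⟩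
    · obtain ⟨q, h1, h2⟩ := exists_rat_btwn hxy
      exact ⟨q, ⟨hD.ordConnected.out hx hy ⟨h1.le, h2.le⟩, Or.inl ⟨q, rfl⟩⟩, h1, h2⟩
    · by_contra! h
      exact hwS ⟨hw, Or.inr (Or.inl ⟨hw, h⟩)⟩
    · by_contra! h
      exact hwS ⟨hw, Or.inr (Or.inr ⟨hw, h⟩)⟩

/-! ### Concave extension from an order-dense subset. -/

namespace IsOrderDenseIn

variable {S D : Set ℝ}

theorem exists_mem_lt (h : IsOrderDenseIn S D) {w : ℝ} (hw : w ∈ D) (hwS : w ∉ S) :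
    ∃ l ∈ S, l < w := by
  obtain ⟨l, hl, hlw⟩ := h.exists_lt w hw hwS
  obtain ⟨q, hq, -, hqw⟩ := h.dense l hl w hw hlw
  exact ⟨q, hq, hqw⟩

theorem exists_mem_gt (h : IsOrderDenseIn S D) {w : ℝ} (hw : w ∈ D) (hwS : w ∉ S) :
    ∃ r ∈ S, w < r := by
  obtain ⟨r, hr, hwr⟩ := h.exists_gt w hw hwS
  obtain ⟨q, hq, hwq, -⟩ := h.dense w hw r hr hwr
  exact ⟨q, hq, hwq⟩

theorem chord_mem_graphHull {f : ℝ → ℝ} {l w r : ℝ} (hl : l ∈ S) (hr : r ∈ S) (hlw : l ≤ w)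
    (hwr : w ≤ r) (hlr : l < r) :
    (w, (r - w) / (r - l) * f l + (w - l) / (r - l) * f r) ∈ graphHull S f := by
  have h0 : 0 < r - l := by linarith
  have h := (convex_convexHull ℝ ((fun x => (x, f x)) '' S)) (mem_graphHull (f := f) hl)
    (mem_graphHull (f := f) hr) (a := (r - w) / (r - l)) (b := (w - l) / (r - l))
    (div_nonneg (by linarith) h0.le) (div_nonneg (by linarith) h0.le) (by field_simp; ring)
  have e : (w, (r - w) / (r - l) * f l + (w - l) / (r - l) * f r) =
      ((r - w) / (r - l)) • (l, f l) + ((w - l) / (r - l)) • (r, f r) := by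
    refine Prod.ext ?_ rfl
    show w = (r - w) / (r - l) * l + (w - l) / (r - l) * r
    field_simp
    ring
  rw [e]
  exact h

theorem graphHull_nonempty (h : IsOrderDenseIn S D) (f : ℝ → ℝ) {w : ℝ} (hw : w ∈ D) :
    {z | (w, z) ∈ graphHull S f}.Nonempty := by
  by_cases hwS : w ∈ S
  · exact ⟨f w, mem_graphHull hwS⟩
  · obtain ⟨l, hl, hlw⟩ := h.exists_mem_lt hw hwS
    obtain ⟨r, hr, hwr⟩ := h.exists_mem_gt hw hwS
    exact ⟨_, chord_mem_graphHull hl hr hlw.le hwr.le (hlw.trans hwr)⟩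

/-- Outside S no supergradient at w itself is at hand, but one at a point p of S between l and w
bounds the hull just as well. -/
theorem bddAbove_graphHull (h : IsOrderDenseIn S D) {f : ℝ → ℝ} (hf : ChordConcaveOn S f) {w : ℝ}
    (hw : w ∈ D) : BddAbove {z | (w, z) ∈ graphHull S f} := by
  by_cases hwS : w ∈ S
  · exact ⟨f w, fun z hz => hf.le_of_mem_graphHull hwS hz⟩
  · obtain ⟨l, hl, hlw⟩ := h.exists_mem_lt hw hwS
    obtain ⟨r, hr, hwr⟩ := h.exists_mem_gt hw hwS
    obtain ⟨p, hp, hlp, hpw⟩ := h.dense l (h.subset hl) w hw hlw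
    obtain ⟨a, ha⟩ := hf.exists_supergradient hl hp hr hlp (hpw.trans hwr)
    exact ⟨f p + a * (w - p), fun z hz => graphHull_subset (convex_setOf_le_affine a (f p) p) ha hz⟩

theorem concaveOn_concaveHull (h : IsOrderDenseIn S D) (hD : Convex ℝ D) {f : ℝ → ℝ}
    (hf : ChordConcaveOn S f) : ConcaveOn ℝ D (concaveHull S f) := by
  refine ⟨hD, fun x hx y hy a b ha hb hab => ?_⟩
  have hxy : a • x + b • y ∈ D := hD hx hy ha hb hab
  refine le_of_forall_pos_sub_le fun ε hε => ?_
  obtain ⟨z₁, hz₁, h₁⟩ := exists_lt_of_lt_csSup (h.graphHull_nonempty f hx)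
    (sub_lt_self (concaveHull S f x) hε)
  obtain ⟨z₂, hz₂, h₂⟩ := exists_lt_of_lt_csSup (h.graphHull_nonempty f hy)
    (sub_lt_self (concaveHull S f y) hε)
  have hz := (convex_convexHull ℝ ((fun x => (x, f x)) '' S)) hz₁ hz₂ ha hb hab
  have hle : a • z₁ + b • z₂ ≤ concaveHull S f (a • x + b • y) :=
    le_csSup (h.bddAbove_graphHull hf hxy) hz
  simp only [smul_eq_mul] at hle ⊢
  have k1 := mul_le_mul_of_nonneg_left h₁.le ha
  have k2 := mul_le_mul_of_nonneg_left h₂.le hb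
  have k3 : a * ε + b * ε = ε := by rw [← add_mul, hab, one_mul]
  linarith

/-- Only the single point w is adjoined to S, so countably many triples are involved. For w outside
S the lower bound comes from chords over [l, q] with q ↓ w in S, where f q is bounded below by the
chord from w to r. -/
theorem concaveHull_eq (h : IsOrderDenseIn S D) (hD : Convex ℝ D) {f : ℝ → ℝ} {w : ℝ} (hw : w ∈ D)
    (hf : ChordConcaveOn (insert w S) f) : concaveHull S f w = f w := by
  have hub : ∀ z, (w, z) ∈ graphHull S f → z ≤ f w := fun z hz =>
    hf.le_of_mem_graphHull (mem_insert w S) (graphHull_mono (subset_insert w S) hz)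
  have hbdd : BddAbove {z | (w, z) ∈ graphHull S f} := ⟨f w, hub⟩
  refine le_antisymm (csSup_le (h.graphHull_nonempty f hw) hub) ?_
  by_cases hwS : w ∈ S
  · exact le_csSup hbdd (mem_graphHull hwS)
  obtain ⟨l, hl, hlw⟩ := h.exists_mem_lt hw hwS
  obtain ⟨r, hr, hwr⟩ := h.exists_mem_gt hw hwS
  have key : ∀ q ∈ S, w < q → q < r →
      ((q - w) / (q - l)) * f l +
        ((w - l) / (q - l)) * (((r - q) * f w + (q - w) * f r) / (r - w)) ≤ concaveHull S f w := by
    intro q hq hwq hqr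
    have h1 := le_csSup hbdd (chord_mem_graphHull (f := f) hl hq hlw.le hwq.le (hlw.trans hwq))
    have h2 := hf w (mem_insert w S) q (mem_insert_of_mem w hq) r (mem_insert_of_mem w hr) hwq hqr
    have h3 : ((r - q) * f w + (q - w) * f r) / (r - w) ≤ f q := by
      rw [div_le_iff₀ (by linarith)]
      linarith
    have h4 : 0 ≤ (w - l) / (q - l) := div_nonneg (by linarith) (by linarith)
    exact (add_le_add le_rfl (mul_le_mul_of_nonneg_left h3 h4)).trans h1
  set F : ℝ → ℝ := fun q => ((q - w) / (q - l)) * f l +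
        ((w - l) / (q - l)) * (((r - q) * f w + (q - w) * f r) / (r - w)) with hF
  have hFw : F w = f w := by
    have h1 : w - l ≠ 0 := by linarith
    have h2 : r - w ≠ 0 := by linarith
    simp only [hF]
    field_simp
    ring
  have hlim : Tendsto F (𝓝 w) (𝓝 (f w)) := by
    have hc : ContinuousAt F w := by
      have h1 : w - l ≠ 0 := by linarith
      have h2 : r - w ≠ 0 := by linarith
      simp only [hF]
      fun_prop (disch := assumption)
    rw [← hFw]
    exact hc
  refine le_of_forall_pos_sub_le fun ε hε => ?_
  obtain ⟨δ, hδ, hball⟩ := Metric.eventually_nhds_iff.1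
    (hlim.eventually (eventually_gt_nhds (sub_lt_self (f w) hε)))
  obtain ⟨q, hq, hwq, hqr⟩ := h.dense w hw (min r (w + δ / 2))
    (hD.ordConnected.out hw (h.subset hr) ⟨le_min hwr.le (by linarith), min_le_left _ _⟩)
    (lt_min hwr (by linarith))
  have h1 := hball (y := q) (by
    rw [Real.dist_eq, abs_of_pos (by linarith)]
    linarith [min_le_right r (w + δ / 2)])
  exact h1.le.trans (key q hq hwq (hqr.trans_le (min_le_left _ _)))

end IsOrderDenseIn

/-- A random function which is concave along each triple of arguments, up to null events, has a
version with concave paths. -/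
theorem hasConcaveVersion_of_ae {Ω : Type*} {m : MeasurableSpace Ω} {P : Measure Ω} {D : Set ℝ}
    (hD : Convex ℝ D) {c : ℝ → Ω → ℝ}
    (h : ∀ x ∈ D, ∀ y ∈ D, ∀ z ∈ D, x < y → y < z →
      ∀ᵐ ω ∂P, (z - y) * c x ω + (y - x) * c z ω ≤ (z - x) * c y ω) :
    HasConcaveVersion P D c := by
  classical
  obtain ⟨S, hSc, hS⟩ := exists_countable_isOrderDenseIn hD
  have key : ∀ T : Set ℝ, T.Countable → T ⊆ D →
      ∀ᵐ ω ∂P, ChordConcaveOn T (fun w => c w ω) := by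
    intro T hT hTD
    refine (ae_ball_iff hT).2 fun x hx => (ae_ball_iff hT).2 fun y hy =>
      (ae_ball_iff hT).2 fun z hz => ?_
    by_cases hxy : x < y
    · by_cases hyz : y < z
      · filter_upwards [h x (hTD hx) y (hTD hy) z (hTD hz) hxy hyz] with ω hω _ _ using hω
      · exact Eventually.of_forall fun ω _ h2 => absurd h2 hyz
    · exact Eventually.of_forall fun ω h1 => absurd h1 hxy
  refine ⟨fun w ω => if ChordConcaveOn S (fun w => c w ω) then
    concaveHull S (fun w => c w ω) w else 0, fun w hw => ?_, fun ω => ?_⟩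
  -- The exceptional null event may depend on w; the version itself is built from S alone.
  · filter_upwards [key (insert w S) (hSc.insert w) (insert_subset hw hS.subset)] with ω hω
    rw [if_pos (hω.mono (subset_insert w S))]
    exact hS.concaveHull_eq hD hw hω
  · by_cases hω : ChordConcaveOn S (fun w => c w ω)
    · simp only [if_pos hω]
      exact hS.concaveOn_concaveHull hD hω
    · simp only [if_neg hω]
      exact concaveOn_const 0 hD

/-! ### Extended conditional expectations -/

section CondExp

open scoped ENNReal

variable {Ω : Type*} {𝒢 m : MeasurableSpace Ω} {P : Measure[m] Ω}

/-- An inequality between densities relative to a sub-`σ`-algebra extends from sets to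
multipliers. -/
theorem lintegral_mul_le_of_setLIntegral_le (h𝒢 : 𝒢 ≤ m)
    {X Y f : Ω → ℝ≥0∞} (hX : Measurable X) (hY : Measurable Y) (hf : Measurable[𝒢] f)
    (h : ∀ A, MeasurableSet[𝒢] A → ∫⁻ ω in A, X ω ∂P ≤ ∫⁻ ω in A, Y ω ∂P) :
    ∫⁻ ω, X ω * f ω ∂P ≤ ∫⁻ ω, Y ω * f ω ∂P := by
  have hle : (P.withDensity X).trim h𝒢 ≤ (P.withDensity Y).trim h𝒢 := by
    refine Measure.le_iff.2 fun A hA => ?_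
    rw [trim_measurableSet_eq h𝒢 hA, trim_measurableSet_eq h𝒢 hA,
      withDensity_apply _ (h𝒢 A hA), withDensity_apply _ (h𝒢 A hA)]
    exact h A hA
  have h1 := lintegral_mono' hle (le_refl f)
  rw [lintegral_trim h𝒢 hf, lintegral_trim h𝒢 hf] at h1
  rwa [lintegral_withDensity_eq_lintegral_mul _ hX (hf.mono h𝒢 le_rfl),
    lintegral_withDensity_eq_lintegral_mul _ hY (hf.mono h𝒢 le_rfl)] at h1

/-- In extended-real arithmetic: a finite difference which dominates another one. -/
theorem le_of_sub_le_sub_of_add_le {a b a' b' g l : ℝ≥0∞}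
    (hfin : (a : EReal) - b ≠ ⊥ ∧ (a : EReal) - b ≠ ⊤)
    (hle : (a' : EReal) - b' ≤ (a : EReal) - b) (hl : l ≠ ∞) (hb' : b' ≤ b + l)
    (h : g + (a + b') ≤ (a' + b) + l) : g ≤ l := by
  -- This uses the convention ∞ - ∞ = -∞: an infinite b would make the difference ⊥ whatever a is.
  have hb : b ≠ ∞ := by
    rintro rfl
    exact hfin.1 (by simp)
  have ha : a ≠ ∞ := by
    rintro rfl
    refine hfin.2 ?_
    lift b to NNReal using hb
    rfl
  have hb'' : b' ≠ ∞ := ne_top_of_le_ne_top (ENNReal.add_ne_top.2 ⟨hb, hl⟩) hb'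
  have ha' : a' ≠ ∞ := by
    rintro rfl
    lift b' to NNReal using hb''
    exact hfin.2 (top_le_iff.1 hle)
  lift a to NNReal using ha
  lift b to NNReal using hb
  lift a' to NNReal using ha'
  lift b' to NNReal using hb''
  have h1 : a' + b ≤ a + b' := by
    have h2 : ((a' : ℝ) : EReal) - ((b' : ℝ) : EReal) ≤ ((a : ℝ) : EReal) - ((b : ℝ) : EReal) := hle
    have h3 : (a' : ℝ) - b' ≤ a - b := by exact_mod_cast h2
    have h4 : (a' : ℝ) + b ≤ a + b' := by linarith
    exact_mod_cast h4
  have h2 : g + ((a : ℝ≥0∞) + b') ≤ l + (a + b') := by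
    refine h.trans ?_
    rw [add_comm]
    exact add_le_add le_rfl (by exact_mod_cast h1)
  exact (ENNReal.add_le_add_iff_right (by simp)).1 h2

/-- If the extended conditional expectation of `X'` does not exceed the finite one of `X`, and
`X + g ≤ X' + L`, then the gain `g` is at most the loss `L` in the mean. -/
theorem lintegral_le_of_extCondExp_le [IsFiniteMeasure P] (h𝒢 : 𝒢 ≤ m)
    {X X' g L : Ω → ℝ} (hX : AEMeasurable X P) (hX' : AEMeasurable X' P) (hg : Measurable g)
    (hL : Measurable L)
    (hfin : ∀ᵐ ω ∂P, extCondExp P 𝒢 X ω ≠ ⊥ ∧ extCondExp P 𝒢 X ω ≠ ⊤)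
    (hle : ∀ᵐ ω ∂P, extCondExp P 𝒢 X' ω ≤ extCondExp P 𝒢 X ω)
    (hg0 : 0 ≤ᵐ[P] g) (hL0 : 0 ≤ᵐ[P] L) (hint : ∫⁻ ω, ENNReal.ofReal (L ω) ∂P ≠ ∞)
    (h : ∀ᵐ ω ∂P, X ω + g ω ≤ X' ω + L ω) :
    ∫⁻ ω, ENNReal.ofReal (g ω) ∂P ≤ ∫⁻ ω, ENNReal.ofReal (L ω) ∂P := by
  set a : Ω → ℝ≥0∞ := fun ω => ENNReal.ofReal (X ω) with ha
  set b : Ω → ℝ≥0∞ := fun ω => ENNReal.ofReal (-X ω) with hb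
  set a' : Ω → ℝ≥0∞ := fun ω => ENNReal.ofReal (X' ω) with ha'
  set b' : Ω → ℝ≥0∞ := fun ω => ENNReal.ofReal (-X' ω) with hb'
  set G : Ω → ℝ≥0∞ := fun ω => ENNReal.ofReal (g ω) with hG
  set l : Ω → ℝ≥0∞ := fun ω => ENNReal.ofReal (L ω) with hl
  have ma : AEMeasurable a P := hX.ennreal_ofReal
  have mb : AEMeasurable b P := hX.neg.ennreal_ofReal
  have ma' : AEMeasurable a' P := hX'.ennreal_ofReal
  have mb' : AEMeasurable b' P := hX'.neg.ennreal_ofReal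
  have mG : AEMeasurable G P := hg.ennreal_ofReal.aemeasurable
  have ml : AEMeasurable l P := hL.ennreal_ofReal.aemeasurable
  -- This keeps the conditional negative part of X' finite, so that no ∞ - ∞ arises when the
  -- inequality below is cancelled.
  have e1 : b' ≤ᵐ[P] b + l := by
    filter_upwards [h, hg0] with ω hω hgω
    have hgω : 0 ≤ g ω := hgω
    exact (ENNReal.ofReal_le_ofReal (by linarith : -X' ω ≤ -X ω + L ω)).trans ENNReal.ofReal_add_le
  have e2 : G + (a + b') ≤ᵐ[P] (a' + b) + l := by
    filter_upwards [h, hg0, hL0] with ω hω hgω hLω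
    have hLω : 0 ≤ L ω := hLω
    have hgω : 0 ≤ g ω := hgω
    simp only [Pi.add_apply, ha, hb, ha', hb', hG, hl, ENNReal.ofReal]
    norm_cast
    rw [← NNReal.coe_le_coe]
    push_cast [Real.coe_toNNReal']
    have k1 := max_zero_sub_max_neg_zero_eq_self (X ω)
    have k2 := max_zero_sub_max_neg_zero_eq_self (X' ω)
    rw [max_eq_left hgω, max_eq_left hLω]
    linarith
  have c1 := (condLExp_mono (mΩ := 𝒢) e1).trans_eq (condLExp_add_left l mb)
  have c2 : condLExp 𝒢 P (G + (a + b')) =ᵐ[P] condLExp 𝒢 P G + (condLExp 𝒢 P a + condLExp 𝒢 P b') :=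
    (condLExp_add_left _ mG).trans ((EventuallyEq.refl _ _).add (condLExp_add_left _ ma))
  have c3 : condLExp 𝒢 P ((a' + b) + l) =ᵐ[P]
      (condLExp 𝒢 P a' + condLExp 𝒢 P b) + condLExp 𝒢 P l :=
    (condLExp_add_left _ (ma'.add mb)).trans ((condLExp_add_left _ ma').add (EventuallyEq.refl _ _))
  have c4 := condLExp_mono (mΩ := 𝒢) e2
  have hfinal : condLExp 𝒢 P G ≤ᵐ[P] condLExp 𝒢 P l := by
    filter_upwards [c1, c2, c3, c4, hfin, hle, condLExp_ne_top (mΩ := 𝒢) hint]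
      with ω k1 k2 k3 k4 k5 k6 k7
    rw [k2, k3] at k4
    exact le_of_sub_le_sub_of_add_le k5 k6 k7 k1 k4
  have := lintegral_mono_ae hfinal
  rwa [lintegral_condLExp h𝒢, lintegral_condLExp h𝒢] at this

end CondExp

/-! ### Perturbations of consumption plans -/

section Plans

open scoped ENNReal

variable {Ω : Type*} {m : MeasurableSpace Ω} {P : Measure Ω} {ℱ : Filtration ℕ m}
  {T t : ℕ} {β R Y : ℕ → Ω → ℝ}

/-- The product `X_{t+1} ⋯ X_s`. -/
def cumProd (X : ℕ → Ω → ℝ) (t s : ℕ) (ω : Ω) : ℝ := ∏ r ∈ Finset.Ioc t s, X r ω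

theorem cumProd_succ (X : ℕ → Ω → ℝ) {t s : ℕ} (h : t ≤ s) (ω : Ω) :
    cumProd X t (s + 1) ω = cumProd X t s ω * X (s + 1) ω :=
  Finset.prod_Ioc_succ_top h _

theorem measurable_cumProd {X : ℕ → Ω → ℝ} (hX : ∀ r, 1 ≤ r → r ≤ T → Measurable[ℱ r] (X r))
    (t : ℕ) {s : ℕ} (hs : s ≤ T) : Measurable[ℱ s] (cumProd X t s) := by
  refine Finset.measurable_prod _ fun r hr => ?_
  rw [Finset.mem_Ioc] at hr
  exact (hX r (by omega) (hr.2.trans hs)).mono (ℱ.mono hr.2) le_rfl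

theorem ae_cumProd_pos {X : ℕ → Ω → ℝ} (hX : ∀ r, 1 ≤ r → r ≤ T → ∀ᵐ ω ∂P, 0 < X r ω) (t : ℕ) :
    ∀ᵐ ω ∂P, ∀ s ≤ T, 0 < cumProd X t s ω := by
  have h : ∀ᵐ ω ∂P, ∀ r, 1 ≤ r → r ≤ T → 0 < X r ω := by
    simpa only [ae_all_iff] using hX
  filter_upwards [h] with ω hω s hs
  refine Finset.prod_pos fun r hr => ?_
  rw [Finset.mem_Ioc] at hr
  exact hω r (by omega) (hr.2.trans hs)

/-- Discounted marginal utility `(∏ β) (∏ R) c_s ^ (-γ)` of time-`t` savings consumed at time `s`;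
it is zero beyond the horizon. -/
def marginalValue (γ : ℝ) (β R : ℕ → Ω → ℝ) (T t : ℕ) (C : ℕ → Ω → ℝ) (s : ℕ) (ω : Ω) : ℝ≥0∞ :=
  if s ≤ T then ENNReal.ofReal (cumProd β t s ω * cumProd R t s ω * C s ω ^ (-γ)) else 0

theorem marginalValue_of_le {γ : ℝ} {C : ℕ → Ω → ℝ} {s : ℕ} (hs : s ≤ T) (ω : Ω) :
    marginalValue γ β R T t C s ω =
      ENNReal.ofReal (cumProd β t s ω * cumProd R t s ω * C s ω ^ (-γ)) := if_pos hs

theorem marginalValue_of_lt {γ : ℝ} {C : ℕ → Ω → ℝ} {s : ℕ} (hs : T < s) (ω : Ω) :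
    marginalValue γ β R T t C s ω = 0 := if_neg (not_le.2 hs)

theorem measurable_marginalValue (E : IsEnvironment P ℱ T β R Y) {γ : ℝ} {C : ℕ → Ω → ℝ}
    (hC : ∀ s, t ≤ s → s ≤ T → Measurable[ℱ s] (C s)) {s : ℕ} (hs : t ≤ s) :
    Measurable[ℱ s] (marginalValue γ β R T t C s) := by
  by_cases hsT : s ≤ T
  · rw [funext (marginalValue_of_le hsT)]
    exact (((measurable_cumProd E.β_meas t hsT).mul (measurable_cumProd E.R_meas t hsT)).mul
      ((hC s hs hsT).pow_const _)).ennreal_ofReal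
  · rw [funext (marginalValue_of_lt (not_le.1 hsT))]
    exact measurable_const

/-- Wealth after consuming `ρ_s (ν_{s+1} - ν_s)` more at each time `s`. -/
theorem wealth_perturb (C : ℕ → Ω → ℝ) (w : ℝ) {ν : ℕ → Ω → ℝ} (hν : ∀ ω, ν t ω = 0) (k : ℕ)
    (ω : Ω) :
    wealth R Y (fun s ω => C s ω + cumProd R t s ω * (ν (s + 1) ω - ν s ω)) t w k ω =
      wealth R Y C t w k ω - cumProd R t (t + k) ω * ν (t + k) ω := by
  induction k with
  | zero => simp [wealth, hν]
  | succ k ih =>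
    have h := cumProd_succ R (Nat.le_add_right t k) ω
    simp only [wealth, ih]
    rw [← add_assoc t k 1, h]
    ring

/-- Here ν_r is the discounted extra consumption accumulated before time r. It is therefore
predictable, and wealth at time r falls by exactly ρ_r ν_r, where ρ is the cumulated return. -/
theorem IsFeasiblePlan.perturb (E : IsEnvironment P ℱ T β R Y) (ht : t ≤ T) {w : ℝ}
    {C : ℕ → Ω → ℝ} (hC : IsFeasiblePlan P ℱ T R Y t w C) {ν : ℕ → Ω → ℝ}
    (hν0 : ∀ ω, ν t ω = 0) (hνm : ∀ s, t ≤ s → s ≤ T → Measurable[ℱ s] (ν (s + 1)))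
    (hpos : ∀ᵐ ω ∂P, ∀ s, t ≤ s → s ≤ T →
      0 < C s ω + cumProd R t s ω * (ν (s + 1) ω - ν s ω))
    (hw : ∀ᵐ ω ∂P, ∀ k, t + k + 1 ≤ T →
      cumProd R t (t + k + 1) ω * ν (t + k + 1) ω ≤ wealth R Y C t w (k + 1) ω)
    (hT : ∀ᵐ ω ∂P, C T ω + cumProd R t T ω * ν (T + 1) ω ≤ wealth R Y C t w (T - t) ω) :
    IsFeasiblePlan P ℱ T R Y t w
      (fun s ω => C s ω + cumProd R t s ω * (ν (s + 1) ω - ν s ω)) where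
  adapted s hs hsT := by
    have hνs : Measurable[ℱ s] (ν s) := by
      rcases hs.eq_or_lt with rfl | h
      · rw [funext hν0]; exact measurable_const
      · obtain ⟨r, rfl⟩ : ∃ r, s = r + 1 := ⟨s - 1, by omega⟩
        exact (hνm r (by omega) (by omega)).mono (ℱ.mono (Nat.le_succ r)) le_rfl
    exact (hC.adapted s hs hsT).add
      ((measurable_cumProd E.R_meas t hsT).mul ((hνm s hs hsT).sub hνs))
  pos s hs hsT := by filter_upwards [hpos] with ω hω using hω s hs hsT
  wealth_nonneg k hk := by
    filter_upwards [hw] with ω hω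
    rw [wealth_perturb C w hν0]
    have := hω k hk
    rw [add_assoc] at this
    linarith
  terminal := by
    filter_upwards [hT] with ω hω
    rw [wealth_perturb C w hν0, Nat.add_sub_cancel' ht]
    linarith

/-- Power marginal utility is homogeneous: if consumption rises by at most the fraction η, marginal
utility falls at most by the factor (1 + η)^(-γ), uniformly over states. -/
theorem marginal_gain_le {γ η c D ρ d : ℝ} (hγ : 0 < γ) (hη : 0 < η) (hc : 0 < c) (hD : 0 < D)
    (hρ : 0 < ρ) (hd : 0 ≤ d) (h : ρ * d ≤ η * c) :
    (1 + η) ^ (-γ) * (D * ρ * c ^ (-γ) * d) ≤ D * (c + ρ * d) ^ (-γ) * (ρ * d) := by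
  have hρd : 0 ≤ ρ * d := mul_nonneg hρ.le hd
  have h1 : ((1 + η) * c) ^ (-γ) ≤ (c + ρ * d) ^ (-γ) :=
    Real.rpow_le_rpow_of_nonpos (by linarith) (by linarith) (by linarith)
  rw [Real.mul_rpow (by linarith) hc.le] at h1
  have h2 := mul_le_mul_of_nonneg_left h1 (mul_nonneg hD.le hρd)
  linarith

theorem marginal_loss_le {γ η c D ρ d : ℝ} (hγ : 0 < γ) (hη : η < 1) (hc : 0 < c)
    (hD : 0 < D) (hρ : 0 < ρ) (hd : d ≤ 0) (h : -(η * c) ≤ ρ * d) :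
    -((1 - η) ^ (-γ) * (D * ρ * c ^ (-γ) * -d)) ≤ D * (c + ρ * d) ^ (-γ) * (ρ * d) := by
  have hρd : ρ * d ≤ 0 := mul_nonpos_of_nonneg_of_nonpos hρ.le hd
  have h1 : (c + ρ * d) ^ (-γ) ≤ ((1 - η) * c) ^ (-γ) :=
    Real.rpow_le_rpow_of_nonpos (mul_pos (by linarith) hc) (by linarith) (by linarith)
  rw [Real.mul_rpow (by linarith) hc.le] at h1
  have h2 := mul_le_mul_of_nonneg_left h1 (mul_nonneg hD.le (neg_nonneg.2 hρd))
  linarith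

variable {u : ℝ → EReal} {A γ : ℝ}

theorem aemeasurable_lifetimeUtility (E : IsEnvironment P ℱ T β R Y)
    (hu : ContinuousOn (felicity u) (Ioi 0)) {w : ℝ} {C : ℕ → Ω → ℝ}
    (hC : IsFeasiblePlan P ℱ T R Y t w C) : AEMeasurable (lifetimeUtility u T β t C) P := by
  classical
  -- Nothing is known about `felicity u` off (0, ∞), so it is replaced by 0 there; the plan is
  -- almost surely positive.
  have hf : Measurable ((Ioi (0 : ℝ)).piecewise (felicity u) (fun _ => 0)) :=
    hu.measurable_piecewise continuousOn_const measurableSet_Ioi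
  have hC0 : ∀ᵐ ω ∂P, ∀ s, t ≤ s → s ≤ T → 0 < C s ω := by
    simpa only [ae_all_iff] using hC.pos
  refine AEMeasurable.congr (f := fun ω => ∑ s ∈ Finset.Icc t T, cumProd β t s ω *
    (Ioi (0 : ℝ)).piecewise (felicity u) (fun _ => 0) (C s ω)) ?_ ?_
  · refine (Finset.measurable_fun_sum _ fun s hs => ?_).aemeasurable
    rw [Finset.mem_Icc] at hs
    exact ((measurable_cumProd E.β_meas t hs.2).mono (ℱ.le s) le_rfl).mul
      (hf.comp ((hC.adapted s hs.1 hs.2).mono (ℱ.le s) le_rfl))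
  · filter_upwards [hC0] with ω hω
    refine Finset.sum_congr rfl fun s hs => ?_
    rw [Finset.mem_Icc] at hs
    rw [piecewise_eq_of_mem _ _ _ (mem_Ioi.2 (hω s hs.1 hs.2))]
    rfl

theorem felicity_le_of_hasDerivAt (hA : 0 < A) (hγ : 0 < γ)
    (hu : ∀ x, 0 < x → HasDerivAt (felicity u) (A * x ^ (-γ)) x) {x y : ℝ} (hx : 0 < x)
    (hy : 0 < y) : felicity u y ≤ felicity u x + A * x ^ (-γ) * (y - x) :=
  le_tangent_of_antitoneOn_deriv hu (fun _ ha _ _ hab => mul_le_mul_of_nonneg_left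
    (Real.rpow_le_rpow_of_nonpos ha hab (by linarith)) hA.le) hx hy

/-- Along a small feasible perturbation of an optimal plan, the expected gain at any one date is at
most the total expected loss. -/
theorem IsOptimalPlan.lintegral_gain_le_loss [IsFiniteMeasure P] (E : IsEnvironment P ℱ T β R Y)
    (hA : 0 < A) (hγ : 0 < γ) (hu : ∀ x, 0 < x → HasDerivAt (felicity u) (A * x ^ (-γ)) x)
    (ht : t ≤ T) {w : ℝ} {C : ℕ → Ω → ℝ} (hC : IsOptimalPlan u P ℱ T β R Y t w C)
    {η : ℝ} (hη : 0 < η) (hη1 : η < 1) {ν : ℕ → Ω → ℝ}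
    (hν0 : ∀ ω, ν t ω = 0) (hνm : ∀ s, t ≤ s → s ≤ T → Measurable[ℱ s] (ν (s + 1)))
    (hlow : ∀ᵐ ω ∂P, ∀ s, t ≤ s → s ≤ T →
      -(η * C s ω) ≤ cumProd R t s ω * (ν (s + 1) ω - ν s ω))
    (hw : ∀ᵐ ω ∂P, ∀ k, t + k + 1 ≤ T →
      cumProd R t (t + k + 1) ω * ν (t + k + 1) ω ≤ wealth R Y C t w (k + 1) ω)
    (hT : ∀ᵐ ω ∂P, C T ω + cumProd R t T ω * ν (T + 1) ω ≤ wealth R Y C t w (T - t) ω)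
    (hfin : ∑ r ∈ Finset.Icc t T,
      ∫⁻ ω, marginalValue γ β R T t C r ω * ENNReal.ofReal (ν r ω - ν (r + 1) ω) ∂P ≠ ∞)
    {s : ℕ} (hts : t ≤ s) (hsT : s ≤ T) {B : Set Ω} (hB : MeasurableSet B)
    (hBη : ∀ᵐ ω ∂P, ω ∈ B → cumProd R t s ω * (ν (s + 1) ω - ν s ω) ≤ η * C s ω) :
    ENNReal.ofReal ((1 + η) ^ (-γ)) * ∫⁻ ω in B,
        marginalValue γ β R T t C s ω * ENNReal.ofReal (ν (s + 1) ω - ν s ω) ∂P ≤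
      ENNReal.ofReal ((1 - η) ^ (-γ)) * ∑ r ∈ Finset.Icc t T,
        ∫⁻ ω, marginalValue γ β R T t C r ω * ENNReal.ofReal (ν r ω - ν (r + 1) ω) ∂P := by
  have hC0 : ∀ᵐ ω ∂P, ∀ s, t ≤ s → s ≤ T → 0 < C s ω := by
    simpa only [ae_all_iff] using hC.feasible.pos
  have hβ := ae_cumProd_pos E.β_pos t
  have hR := ae_cumProd_pos E.R_pos t
  have hpos : ∀ᵐ ω ∂P, ∀ s, t ≤ s → s ≤ T →
      0 < C s ω + cumProd R t s ω * (ν (s + 1) ω - ν s ω) := by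
    filter_upwards [hC0, hlow] with ω h1 h2 s hs hsT
    have := mul_lt_mul_of_pos_right hη1 (h1 s hs hsT)
    linarith [h2 s hs hsT]
  have hC' := hC.feasible.perturb E ht hν0 hνm hpos hw hT
  set C' : ℕ → Ω → ℝ := fun s ω => C s ω + cumProd R t s ω * (ν (s + 1) ω - ν s ω) with hC'def
  have hcont : ContinuousOn (felicity u) (Ioi 0) :=
    fun x hx => (hu x hx).continuousAt.continuousWithinAt
  have hνM : ∀ s, t ≤ s → s ≤ T + 1 → Measurable (ν s) := by
    intro s hs hsT
    rcases hs.eq_or_lt with rfl | h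
    · rw [funext hν0]; exact measurable_const
    · obtain ⟨r, rfl⟩ : ∃ r, s = r + 1 := ⟨s - 1, by omega⟩
      exact (hνm r (by omega) (by omega)).mono (ℱ.le r) le_rfl
  set mv : ℕ → Ω → ℝ := fun s ω => cumProd β t s ω * cumProd R t s ω * C s ω ^ (-γ) with hmv
  have hmvM : ∀ s, t ≤ s → s ≤ T → Measurable (mv s) := fun s hs hsT =>
    (((measurable_cumProd E.β_meas t hsT).mul (measurable_cumProd E.R_meas t hsT)).mul
      ((hC.feasible.adapted s hs hsT).pow_const _)).mono (ℱ.le s) le_rfl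
  have hmv0 : ∀ᵐ ω ∂P, ∀ s, t ≤ s → s ≤ T → 0 ≤ mv s ω := by
    filter_upwards [hC0, hβ, hR] with ω h1 h2 h3 s hs hsT
    exact mul_nonneg (mul_nonneg (h2 s hsT).le (h3 s hsT).le)
      (Real.rpow_nonneg (h1 s hs hsT).le _)
  have hη' : 0 < 1 - η := by linarith
  have hη'' : 0 < 1 + η := by linarith
  have hp1 : 0 < A * (1 + η) ^ (-γ) := mul_pos hA (Real.rpow_pos_of_pos hη'' _)
  have hp2 : 0 < A * (1 - η) ^ (-γ) := mul_pos hA (Real.rpow_pos_of_pos hη' _)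
  -- Gains are kept only at date s and on B, where the increase is at most the fraction η; losses
  -- are counted at every date.
  set g : Ω → ℝ := fun ω => A * (1 + η) ^ (-γ) *
    B.indicator (fun ω => mv s ω * max (ν (s + 1) ω - ν s ω) 0) ω with hg
  set L : Ω → ℝ := fun ω => ∑ r ∈ Finset.Icc t T, A * (1 - η) ^ (-γ) *
    (mv r ω * max (ν r ω - ν (r + 1) ω) 0) with hL
  have hgM : Measurable g := by
    refine measurable_const.mul (Measurable.indicator ?_ hB)
    exact (hmvM s hts hsT).mul
      (((hνM (s + 1) (by omega) (by omega)).sub (hνM s hts (by omega))).max measurable_const)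
  have hLM : Measurable L := by
    refine Finset.measurable_fun_sum _ fun r hr => measurable_const.mul ?_
    rw [Finset.mem_Icc] at hr
    exact (hmvM r hr.1 hr.2).mul
      (((hνM r hr.1 (by omega)).sub (hνM (r + 1) (by omega) (by omega))).max measurable_const)
  have hg0 : 0 ≤ᵐ[P] g := by
    filter_upwards [hmv0] with ω h
    refine mul_nonneg hp1.le ?_
    by_cases hω : ω ∈ B
    · rw [indicator_of_mem hω]
      exact mul_nonneg (h s hts hsT) (le_max_right _ _)
    · rw [indicator_of_notMem hω]
  have hL0 : 0 ≤ᵐ[P] L := by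
    filter_upwards [hmv0] with ω h
    refine Finset.sum_nonneg fun r hr => mul_nonneg hp2.le (mul_nonneg ?_ (le_max_right _ _))
    rw [Finset.mem_Icc] at hr
    exact h r hr.1 hr.2
  have hmax : ∀ x : ℝ, ENNReal.ofReal (max x 0) = ENNReal.ofReal x := fun x => by
    rw [ENNReal.ofReal_max]; simp
  have hgint : ∫⁻ ω, ENNReal.ofReal (g ω) ∂P = ENNReal.ofReal (A * (1 + η) ^ (-γ)) *
      ∫⁻ ω in B, marginalValue γ β R T t C s ω * ENNReal.ofReal (ν (s + 1) ω - ν s ω) ∂P := by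
    rw [← lintegral_indicator hB, ← lintegral_const_mul' _ _ ENNReal.ofReal_ne_top]
    refine lintegral_congr_ae ?_
    filter_upwards [hmv0] with ω h
    simp only [hg]
    rw [ENNReal.ofReal_mul hp1.le]
    congr 1
    by_cases hω : ω ∈ B
    · rw [indicator_of_mem hω, indicator_of_mem hω, ENNReal.ofReal_mul (h s hts hsT), hmax,
        marginalValue_of_le hsT]
    · rw [indicator_of_notMem hω, indicator_of_notMem hω, ENNReal.ofReal_zero]
  have hLint : ∫⁻ ω, ENNReal.ofReal (L ω) ∂P = ENNReal.ofReal (A * (1 - η) ^ (-γ)) *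
      ∑ r ∈ Finset.Icc t T,
        ∫⁻ ω, marginalValue γ β R T t C r ω * ENNReal.ofReal (ν r ω - ν (r + 1) ω) ∂P := by
    rw [Finset.mul_sum]
    have : ∀ r ∈ Finset.Icc t T, Measurable fun ω => ENNReal.ofReal (A * (1 - η) ^ (-γ)) *
        (marginalValue γ β R T t C r ω * ENNReal.ofReal (ν r ω - ν (r + 1) ω)) := by
      intro r hr
      rw [Finset.mem_Icc] at hr
      refine measurable_const.mul (((measurable_marginalValue E hC.feasible.adapted hr.1).mono
        (ℱ.le r) le_rfl).mul ?_)
      exact ((hνM r hr.1 (by omega)).sub (hνM (r + 1) (by omega) (by omega))).ennreal_ofReal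
    simp_rw [← lintegral_const_mul' _ _ ENNReal.ofReal_ne_top]
    rw [← lintegral_finsetSum _ this]
    refine lintegral_congr_ae ?_
    filter_upwards [hmv0] with ω h
    simp only [hL]
    rw [ENNReal.ofReal_sum_of_nonneg]
    · refine Finset.sum_congr rfl fun r hr => ?_
      rw [Finset.mem_Icc] at hr
      rw [ENNReal.ofReal_mul hp2.le, ENNReal.ofReal_mul (h r hr.1 hr.2), hmax,
        marginalValue_of_le hr.2]
    · intro r hr
      rw [Finset.mem_Icc] at hr
      exact mul_nonneg hp2.le (mul_nonneg (h r hr.1 hr.2) (le_max_right _ _))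
  have hmain := lintegral_le_of_extCondExp_le (ℱ.le t)
    (aemeasurable_lifetimeUtility E hcont hC.feasible) (aemeasurable_lifetimeUtility E hcont hC')
    hgM hLM hC.finite (hC.optimal C' hC') hg0 hL0
    (by rw [hLint]; exact ENNReal.mul_ne_top ENNReal.ofReal_ne_top hfin)
    (by
      filter_upwards [hC0, hβ, hR, hpos, hlow, hBη] with ω h1 h2 h3 h4 h5 h6
      have hterm : ∀ r ∈ Finset.Icc t T,
          cumProd β t r ω * felicity u (C r ω) + (if r = s then g ω else 0) ≤
          cumProd β t r ω * felicity u (C' r ω) +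
            A * (1 - η) ^ (-γ) * (mv r ω * max (ν r ω - ν (r + 1) ω) 0) := by
        intro r hr
        rw [Finset.mem_Icc] at hr
        obtain ⟨htr, hrT⟩ := hr
        have hc := h1 r htr hrT
        have hD := h2 r hrT
        have hρ := h3 r hrT
        have hc' : 0 < C' r ω := h4 r htr hrT
        -- The tangent is taken at the perturbed consumption, which bounds the change in utility
        -- from below.
        have htan := mul_le_mul_of_nonneg_left (felicity_le_of_hasDerivAt hA hγ hu hc' hc) hD.le
        have hdiff : C r ω - C' r ω = -(cumProd R t r ω * (ν (r + 1) ω - ν r ω)) := by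
          simp only [hC'def]; ring
        rw [hdiff] at htan
        rcases le_total 0 (ν (r + 1) ω - ν r ω) with hd | hd
        · rw [max_eq_right (by linarith : ν r ω - ν (r + 1) ω ≤ 0)]
          have hnn : 0 ≤ cumProd β t r ω * (A * C' r ω ^ (-γ)) *
              (cumProd R t r ω * (ν (r + 1) ω - ν r ω)) :=
            mul_nonneg (mul_nonneg hD.le (mul_nonneg hA.le (Real.rpow_nonneg hc'.le _)))
              (mul_nonneg hρ.le hd)
          by_cases hrs : r = s
          · subst hrs
            by_cases hω : ω ∈ B
            · have := mul_le_mul_of_nonneg_left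
                (marginal_gain_le hγ hη hc hD hρ hd (h6 hω)) hA.le
              simp only [if_true, hg, indicator_of_mem hω, max_eq_left hd, hmv]
              simp only [hC'def] at htan ⊢
              linarith
            · simp only [if_true, hg, indicator_of_notMem hω]
              linarith
          · simp only [if_neg hrs]
            linarith
        · have hl := mul_le_mul_of_nonneg_left
            (marginal_loss_le hγ hη1 hc hD hρ hd (h5 r htr hrT)) hA.le
          rw [max_eq_left (by linarith : 0 ≤ ν r ω - ν (r + 1) ω)]
          have hg' : (if r = s then g ω else 0) = 0 := by
            split_ifs with hrs
            · subst hrs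
              by_cases hω : ω ∈ B
              · simp only [hg, indicator_of_mem hω, max_eq_right hd, mul_zero]
              · simp only [hg, indicator_of_notMem hω, mul_zero]
            · rfl
          rw [hg']
          simp only [hmv, hC'def] at htan hl ⊢
          linarith
      have := Finset.sum_le_sum hterm
      rw [Finset.sum_add_distrib, Finset.sum_add_distrib, Finset.sum_ite_eq',
        if_pos (Finset.mem_Icc.2 ⟨hts, hsT⟩)] at this
      exact this)
  rw [hgint, hLint, ENNReal.ofReal_mul hA.le, ENNReal.ofReal_mul hA.le, mul_assoc, mul_assoc] at hmain
  exact (ENNReal.mul_le_mul_iff_right (by simpa using hA) ENNReal.ofReal_ne_top).1 hmain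

end Plans

/-! ### Euler equations -/

section Euler

open scoped ENNReal

variable {Ω : Type*} {m : MeasurableSpace Ω} {P : Measure Ω} {ℱ : Filtration ℕ m}
  {T t : ℕ} {β R Y : ℕ → Ω → ℝ} {u : ℝ → EReal} {A γ : ℝ}

/-- Both factors tend to 1 as η ↓ 0, so the distortion caused by finite perturbations disappears. -/
theorem le_of_forall_rpow_mul_le {x y : ℝ≥0∞} (γ : ℝ)
    (h : ∀ η : ℝ, 0 < η → η < 1 →
      ENNReal.ofReal ((1 + η) ^ (-γ)) * x ≤ ENNReal.ofReal ((1 - η) ^ (-γ)) * y) : x ≤ y := by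
  have h1 : Tendsto (fun η : ℝ => ENNReal.ofReal ((1 + η) ^ (-γ))) (𝓝[>] 0) (𝓝 1) := by
    have : ContinuousAt (fun η : ℝ => ENNReal.ofReal ((1 + η) ^ (-γ))) 0 :=
      ENNReal.continuous_ofReal.continuousAt.comp
        (ContinuousAt.rpow_const (by fun_prop) (Or.inl (by norm_num)))
    have := this.tendsto.mono_left (nhdsWithin_le_nhds (s := Ioi 0))
    simpa using this
  have h2 : Tendsto (fun η : ℝ => ENNReal.ofReal ((1 - η) ^ (-γ))) (𝓝[>] 0) (𝓝 1) := by
    have : ContinuousAt (fun η : ℝ => ENNReal.ofReal ((1 - η) ^ (-γ))) 0 :=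
      ENNReal.continuous_ofReal.continuousAt.comp
        (ContinuousAt.rpow_const (by fun_prop) (Or.inl (by norm_num)))
    have := this.tendsto.mono_left (nhdsWithin_le_nhds (s := Ioi 0))
    simpa using this
  have h3 := ENNReal.Tendsto.mul_const (b := x) h1 (Or.inl one_ne_zero)
  have h4 := ENNReal.Tendsto.mul_const (b := y) h2 (Or.inl one_ne_zero)
  rw [one_mul] at h3 h4
  refine le_of_tendsto_of_tendsto h3 h4 ?_
  filter_upwards [Ioo_mem_nhdsGT (zero_lt_one (α := ℝ))] with η hη using h η hη.1 hη.2

theorem setLIntegral_le_of_exhaustion {X : Ω → ℝ≥0∞} {S : Set Ω} {B : ℕ → Set Ω} (hB : Monotone B)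
    (hS : ∀ᵐ ω ∂P, ω ∈ S → ∃ n, ω ∈ B n) {a b : ℝ≥0∞} (h : ∀ n, a * ∫⁻ ω in B n, X ω ∂P ≤ b) :
    a * ∫⁻ ω in S, X ω ∂P ≤ b := by
  have h1 : ∫⁻ ω in S, X ω ∂P ≤ ⨆ n, ∫⁻ ω in B n, X ω ∂P := by
    rw [← setLIntegral_iUnion_of_directed _ hB.directed_le]
    refine lintegral_mono_set' ?_
    filter_upwards [hS] with ω hω hωS
    exact mem_iUnion.2 (hω hωS)
  refine (mul_le_mul_right h1 a).trans ?_
  rw [ENNReal.mul_iSup]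
  exact iSup_le h

theorem exists_nat_forall_le_mul {x : ℝ} {y : ℝ} (hy : 0 < y) : ∃ n : ℕ, x ≤ (n + 1) * y := by
  obtain ⟨n, hn⟩ := exists_nat_ge (x / y)
  refine ⟨n, ?_⟩
  rw [div_le_iff₀ hy] at hn
  linarith

theorem setLIntegral_mul_indicator {X : Ω → ℝ≥0∞} {S B : Set Ω} (hSB : S ⊆ B)
    (hS : MeasurableSet S) {e : ℝ} :
    ∫⁻ ω in S, X ω * ENNReal.ofReal (B.indicator (fun _ => e) ω) ∂P =
      ENNReal.ofReal e * ∫⁻ ω in S, X ω ∂P := by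
  rw [← lintegral_const_mul' _ _ ENNReal.ofReal_ne_top]
  refine setLIntegral_congr_fun hS fun ω hω => ?_
  simp only [indicator_of_mem (hSB hω)]
  rw [mul_comm]

theorem lintegral_mul_indicator {X : Ω → ℝ≥0∞} {B : Set Ω} (hB : MeasurableSet B) {e : ℝ} :
    ∫⁻ ω, X ω * ENNReal.ofReal (B.indicator (fun _ => e) ω) ∂P =
      ENNReal.ofReal e * ∫⁻ ω in B, X ω ∂P := by
  rw [← lintegral_const_mul' _ _ ENNReal.ofReal_ne_top, ← lintegral_indicator hB]
  refine lintegral_congr fun ω => ?_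
  by_cases hω : ω ∈ B
  · rw [indicator_of_mem hω, indicator_of_mem hω, mul_comm]
  · rw [indicator_of_notMem hω, indicator_of_notMem hω]
    simp

/-- The events on which consumption is not small relative to the discount factor, and marginal
values are bounded. -/
def interiorEvent (γ η : ℝ) (β R : ℕ → Ω → ℝ) (T t : ℕ) (C : ℕ → Ω → ℝ) (s n : ℕ) : Set Ω :=
  {ω | 0 < C s ω} ∩ ({ω | cumProd R t s ω ≤ (n + 1) * (η * C s ω)} ∩
    {ω | marginalValue γ β R T t C s ω ≤ n + 1})

theorem measurableSet_interiorEvent (E : IsEnvironment P ℱ T β R Y) {η : ℝ} {C : ℕ → Ω → ℝ}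
    (hC : ∀ s, t ≤ s → s ≤ T → Measurable[ℱ s] (C s)) {s : ℕ} (hs : t ≤ s) (hsT : s ≤ T) (n : ℕ) :
    MeasurableSet[ℱ s] (interiorEvent γ η β R T t C s n) := by
  have h1 := measurable_cumProd E.R_meas t hsT
  have h2 := hC s hs hsT
  have h3 := measurable_marginalValue E (γ := γ) hC hs
  exact MeasurableSet.inter (measurableSet_lt measurable_const h2)
    (MeasurableSet.inter
      (measurableSet_le h1 (Measurable.const_mul (Measurable.const_mul h2 η) ((n : ℝ) + 1)))
      (measurableSet_le h3 measurable_const))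

theorem monotone_interiorEvent {η : ℝ} {C : ℕ → Ω → ℝ} {s : ℕ} (hη : 0 < η) :
    Monotone (interiorEvent γ η β R T t C s) := by
  rintro n k hnk ω ⟨h0, h1, h2⟩
  simp only [mem_ofPred_eq] at h0 h1 h2
  have hnk' : (n : ℝ) ≤ k := by exact_mod_cast hnk
  have hnk'' : (n : ℝ≥0∞) ≤ k := by exact_mod_cast hnk
  have := mul_pos hη h0
  exact ⟨h0, h1.trans (by gcongr), h2.trans (by gcongr)⟩

theorem exists_mem_interiorEvent {η : ℝ} {C : ℕ → Ω → ℝ} {s : ℕ} {ω : Ω} (hη : 0 < η)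
    (hC : 0 < C s ω) : ∃ n, ω ∈ interiorEvent γ η β R T t C s n := by
  obtain ⟨n₁, h₁⟩ := exists_nat_forall_le_mul (x := cumProd R t s ω) (mul_pos hη hC)
  have hfin : marginalValue γ β R T t C s ω ≠ ∞ := by
    unfold marginalValue
    split_ifs <;> simp
  obtain ⟨n₂, h₂⟩ := ENNReal.exists_nat_gt hfin
  have h := mul_pos hη hC
  refine ⟨max n₁ n₂, hC, h₁.trans ?_, h₂.le.trans ?_⟩
  · gcongr
    exact le_max_left _ _
  · calc (n₂ : ℝ≥0∞) ≤ ((max n₁ n₂ : ℕ) : ℝ≥0∞) := by exact_mod_cast le_max_right _ _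
      _ ≤ _ := le_self_add

theorem setLIntegral_interiorEvent_lt_top [IsFiniteMeasure P] {η : ℝ} {C : ℕ → Ω → ℝ} {s n : ℕ}
    {S : Set Ω} (hSm : MeasurableSet S) (hS : S ⊆ interiorEvent γ η β R T t C s n) :
    ∫⁻ ω in S, marginalValue γ β R T t C s ω ∂P < ∞ := by
  refine (setLIntegral_mono' (g := fun _ => (n : ℝ≥0∞) + 1) hSm fun ω hω => (hS hω).2.2).trans_lt ?_
  rw [setLIntegral_const]
  exact ENNReal.mul_lt_top (by simp [lt_top_iff_ne_top]) (measure_lt_top _ _)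

/-- Saving a little more is never profitable: discounted marginal utility is a supermartingale. -/
theorem IsOptimalPlan.setLIntegral_marginalValue_succ_le [IsFiniteMeasure P]
    (E : IsEnvironment P ℱ T β R Y) (hA : 0 < A) (hγ : 0 < γ)
    (hu : ∀ x, 0 < x → HasDerivAt (felicity u) (A * x ^ (-γ)) x)
    (ht : t ≤ T) {w : ℝ} {C : ℕ → Ω → ℝ} (hC : IsOptimalPlan u P ℱ T β R Y t w C)
    {s : ℕ} (hs : t ≤ s) {S : Set Ω} (hS : MeasurableSet[ℱ s] S) :
    ∫⁻ ω in S, marginalValue γ β R T t C (s + 1) ω ∂P ≤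
      ∫⁻ ω in S, marginalValue γ β R T t C s ω ∂P := by
  rcases Nat.lt_or_ge T (s + 1) with hsT | hsT
  · simp [marginalValue_of_lt hsT]
  have hC0 : ∀ᵐ ω ∂P, ∀ s, t ≤ s → s ≤ T → 0 < C s ω := by
    simpa only [ae_all_iff] using hC.feasible.pos
  have hR := ae_cumProd_pos E.R_pos t
  refine le_of_forall_rpow_mul_le γ fun η hη hη1 => ?_
  -- The extra saving is decided on B₀, which is known at time s; its gain is counted only on B₁,
  -- which also uses time s + 1.
  set B₀ : ℕ → Set Ω := fun n => S ∩ interiorEvent γ η β R T t C s n with hB₀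
  set B₁ : ℕ → Set Ω := fun n => B₀ n ∩ interiorEvent γ η β R T t C (s + 1) n with hB₁
  have hB₀m : ∀ n, MeasurableSet[ℱ s] (B₀ n) := fun n => MeasurableSet.inter hS
    (measurableSet_interiorEvent E hC.feasible.adapted hs (by omega) n)
  have hB₁m : ∀ n, MeasurableSet (B₁ n) := fun n => ((ℱ.le s) _ (hB₀m n)).inter
    ((ℱ.le (s + 1)) _ (measurableSet_interiorEvent E hC.feasible.adapted (by omega) hsT n))
  have hB₁mono : Monotone B₁ := fun n k hnk => inter_subset_inter
    (inter_subset_inter le_rfl (monotone_interiorEvent hη hnk)) (monotone_interiorEvent hη hnk)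
  refine setLIntegral_le_of_exhaustion hB₁mono ?_ fun n => ?_
  · filter_upwards [hC0] with ω hω hωS
    obtain ⟨n₁, h₁⟩ := exists_mem_interiorEvent (γ := γ) (β := β) (R := R) (t := t) (T := T) hη
      (hω s hs (by omega))
    obtain ⟨n₂, h₂⟩ := exists_mem_interiorEvent (γ := γ) (β := β) (R := R) (t := t) (T := T) hη
      (hω (s + 1) (by omega) hsT)
    exact ⟨max n₁ n₂, ⟨hωS, monotone_interiorEvent hη (le_max_left _ _) h₁⟩,
      monotone_interiorEvent hη (le_max_right _ _) h₂⟩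
  -- This size matches the factor n + 1 in `interiorEvent`, so ρ ε is at most the fraction η of
  -- consumption.
  set ε : ℝ := 1 / ((n : ℝ) + 1) with hε
  have hn : (0 : ℝ) < (n : ℝ) + 1 := by positivity
  have hε0 : 0 < ε := by positivity
  have hscale : ∀ r ω, ω ∈ interiorEvent γ η β R T t C r n → cumProd R t r ω * ε ≤ η * C r ω := by
    intro r ω hω
    have h1 : cumProd R t r ω ≤ (n + 1) * (η * C r ω) := hω.2.1
    rw [hε, mul_one_div, div_le_iff₀ hn]
    linarith
  set I : Ω → ℝ := (B₀ n).indicator (fun _ => ε) with hI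
  have hI0 : ∀ ω, 0 ≤ I ω := fun ω => by
    by_cases hω : ω ∈ B₀ n
    · simp only [hI, indicator_of_mem hω]; exact hε0.le
    · simp only [hI, indicator_of_notMem hω]; exact le_rfl
  have hIs : ∀ ω, cumProd R t s ω * I ω ≤ η * C s ω ∨ I ω = 0 := by
    intro ω
    by_cases hω : ω ∈ B₀ n
    · left
      simp only [hI, indicator_of_mem hω]
      exact hscale s ω hω.2
    · right
      simp only [hI, indicator_of_notMem hω]
  have hIm : Measurable[ℱ s] I := Measurable.indicator measurable_const (hB₀m n)
  -- A single nonzero entry: save I (in discounted units) at time s and consume it at time s + 1.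
  set ν : ℕ → Ω → ℝ := fun r ω => if r = s + 1 then -I ω else 0 with hν
  have hν1 : ∀ ω, ν (s + 1) ω = -I ω := fun ω => by simp [hν]
  have hν2 : ∀ r, r ≠ s + 1 → ∀ ω, ν r ω = 0 := fun r hr ω => by simp [hν, hr]
  have hsum : ∑ r ∈ Finset.Icc t T,
      ∫⁻ ω, marginalValue γ β R T t C r ω * ENNReal.ofReal (ν r ω - ν (r + 1) ω) ∂P =
      ENNReal.ofReal ε * ∫⁻ ω in B₀ n, marginalValue γ β R T t C s ω ∂P := by
    rw [Finset.sum_eq_single s]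
    · rw [← lintegral_mul_indicator ((ℱ.le s) _ (hB₀m n))]
      simp only [hν1, hν2 s (by omega), zero_sub, neg_neg]
      rfl
    · intro r _ hr
      by_cases hr1 : r = s + 1
      · subst hr1
        simp only [hν1, hν2 (s + 1 + 1) (by omega)]
        refine (lintegral_congr fun ω => ?_).trans lintegral_zero
        rw [ENNReal.ofReal_of_nonpos (by linarith [hI0 ω]), mul_zero]
      · simp [hν2 r hr1, hν2 (r + 1) (by omega)]
    · intro h
      exact absurd (Finset.mem_Icc.2 ⟨hs, by omega⟩) h
  have hfin : ∫⁻ ω in B₀ n, marginalValue γ β R T t C s ω ∂P < ∞ :=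
    setLIntegral_interiorEvent_lt_top ((ℱ.le s) _ (hB₀m n)) inter_subset_right
  have key := hC.lintegral_gain_le_loss E hA hγ hu ht hη hη1 (ν := ν) (hν2 t (by omega))
    (fun r hr hrT => by
      by_cases hr1 : r = s
      · subst hr1
        rw [funext hν1]
        exact hIm.neg
      · rw [funext (hν2 (r + 1) (by omega))]
        exact measurable_const)
    (by
      filter_upwards [hC0, hR] with ω h1 h2 r hr hrT
      have hcr := mul_pos hη (h1 r hr hrT)
      by_cases hr1 : r = s
      · subst hr1
        rw [hν1, hν2 r (by omega)]
        rcases hIs ω with h | h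
        · linarith
        · rw [h]; linarith
      · by_cases hr2 : r = s + 1
        · subst hr2
          rw [hν1, hν2 (s + 1 + 1) (by omega)]
          have := mul_nonneg (h2 (s + 1) hrT).le (hI0 ω)
          linarith
        · rw [hν2 r hr2, hν2 (r + 1) (by omega)]
          linarith)
    (by
      have hW : ∀ᵐ ω ∂P, ∀ k, t + k + 1 ≤ T → 0 ≤ wealth R Y C t w (k + 1) ω := by
        simpa only [ae_all_iff] using hC.feasible.wealth_nonneg
      filter_upwards [hW, hR] with ω h1 h2 k hk
      refine le_trans ?_ (h1 k hk)
      by_cases hr : t + k + 1 = s + 1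
      · rw [hr, hν1]
        have := mul_nonneg (h2 (s + 1) (by omega)).le (hI0 ω)
        linarith
      · rw [hν2 _ hr, mul_zero])
    (by
      filter_upwards [hC.feasible.terminal] with ω hω
      rw [hν2 (T + 1) (by omega), mul_zero, add_zero]
      exact hω)
    (by rw [hsum]; exact ENNReal.mul_ne_top ENNReal.ofReal_ne_top hfin.ne)
    (s := s + 1) (by omega) hsT (hB₁m n)
    (Eventually.of_forall fun ω hω => by
      rw [hν1, hν2 (s + 1 + 1) (by omega)]
      have := hscale (s + 1) ω hω.2
      simp only [hI, indicator_of_mem hω.1]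
      linarith)
  rw [hsum] at key
  simp only [hν1, hν2 (s + 1 + 1) (by omega), zero_sub, neg_neg] at key
  rw [setLIntegral_mul_indicator inter_subset_left (hB₁m n)] at key
  have hεne : ENNReal.ofReal ε ≠ 0 := by simpa using hε0
  rw [mul_left_comm, mul_left_comm (ENNReal.ofReal ((1 - η) ^ (-γ))),
    ENNReal.mul_le_mul_iff_right hεne ENNReal.ofReal_ne_top] at key
  exact key.trans (mul_le_mul_right (lintegral_mono_set inter_subset_left) _)

theorem IsOptimalPlan.lintegral_marginalValue_succ_mul_le [IsFiniteMeasure P]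
    (E : IsEnvironment P ℱ T β R Y) (hA : 0 < A) (hγ : 0 < γ)
    (hu : ∀ x, 0 < x → HasDerivAt (felicity u) (A * x ^ (-γ)) x)
    (ht : t ≤ T) {w : ℝ} {C : ℕ → Ω → ℝ} (hC : IsOptimalPlan u P ℱ T β R Y t w C)
    {s : ℕ} (hs : t ≤ s) {f : Ω → ℝ≥0∞} (hf : Measurable[ℱ s] f) :
    ∫⁻ ω, marginalValue γ β R T t C (s + 1) ω * f ω ∂P ≤
      ∫⁻ ω, marginalValue γ β R T t C s ω * f ω ∂P :=
  lintegral_mul_le_of_setLIntegral_le (ℱ.le s)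
    ((measurable_marginalValue E hC.feasible.adapted (by omega)).mono (ℱ.le (s + 1)) le_rfl)
    ((measurable_marginalValue E hC.feasible.adapted hs).mono (ℱ.le s) le_rfl) hf
    fun _ hS => hC.setLIntegral_marginalValue_succ_le E hA hγ hu ht hs hS

end Euler

/-! ### The reverse Euler inequality where the optimal plan is strictly richer than a feasible one.
-/

section EulerEquality

open scoped ENNReal

variable {Ω : Type*} {m : MeasurableSpace Ω} {P : Measure Ω} {ℱ : Filtration ℕ m}
  {T t : ℕ} {β R Y : ℕ → Ω → ℝ} {u : ℝ → EReal} {A γ : ℝ}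

/-- The running minimum of `G` after time `s`, started at `x` at time `s + 1`, stopped at `0`;
zero up to time `s`. -/
def stoppedMin (s : ℕ) (x : ℝ) (G : ℕ → ℝ) : ℕ → ℝ
  | 0 => 0
  | r + 1 => if r < s then 0 else if r = s then x else max 0 (min (stoppedMin s x G r) (G (r + 1)))

section StoppedMin

variable {s : ℕ} {x : ℝ} {G : ℕ → ℝ}

theorem stoppedMin_of_le {r : ℕ} (h : r ≤ s) : stoppedMin s x G r = 0 := by
  cases r with
  | zero => rfl
  | succ r => simp [stoppedMin, Nat.lt_of_succ_le h]

theorem stoppedMin_start : stoppedMin s x G (s + 1) = x := by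
  simp [stoppedMin]

theorem stoppedMin_succ {r : ℕ} (h : s < r) :
    stoppedMin s x G (r + 1) = max 0 (min (stoppedMin s x G r) (G (r + 1))) := by
  simp [stoppedMin, not_lt.2 h.le, h.ne']

theorem stoppedMin_nonneg (hx : 0 ≤ x) (r : ℕ) : 0 ≤ stoppedMin s x G r := by
  cases r with
  | zero => exact le_rfl
  | succ r =>
    rcases lt_trichotomy r s with h | rfl | h
    · rw [stoppedMin_of_le h]
    · rwa [stoppedMin_start]
    · rw [stoppedMin_succ h]; exact le_max_left _ _

theorem stoppedMin_succ_le (hx : 0 ≤ x) {r : ℕ} (h : s < r) :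
    stoppedMin s x G (r + 1) ≤ stoppedMin s x G r := by
  rw [stoppedMin_succ h]
  exact max_le (stoppedMin_nonneg hx r) (min_le_left _ _)

theorem stoppedMin_le (hx : x ≤ max 0 (G (s + 1))) (r : ℕ) :
    stoppedMin s x G r ≤ max 0 (G r) := by
  cases r with
  | zero => exact le_max_left _ _
  | succ r =>
    rcases lt_trichotomy r s with h | rfl | h
    · rw [stoppedMin_of_le h]; exact le_max_left _ _
    · rwa [stoppedMin_start]
    · rw [stoppedMin_succ h]; exact max_le_max le_rfl (min_le_right _ _)

/-- With G the fraction η of the wealth gap, the drop of G at r is η (C_r - C'_r) / ρ_r. So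
unwinding never cuts consumption by more than the fraction η. -/
theorem stoppedMin_sub_succ_le (hx0 : 0 ≤ x) (hx : x ≤ max 0 (G (s + 1))) {r : ℕ} (h : s < r) :
    stoppedMin s x G r - stoppedMin s x G (r + 1) ≤ max 0 (G r - G (r + 1)) := by
  have h1 := stoppedMin_le hx r
  have h0 := stoppedMin_nonneg (s := s) (G := G) hx0 r
  rw [stoppedMin_succ h]
  rcases le_total (stoppedMin s x G r) (G (r + 1)) with h2 | h2
  · rw [min_eq_left h2, max_eq_right h0, sub_self]
    exact le_max_left _ _
  · rw [min_eq_right h2]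
    rcases le_total (G r) 0 with h3 | h3
    · rw [max_eq_left h3] at h1
      linarith [le_max_left 0 (G (r + 1)), le_max_left 0 (G r - G (r + 1))]
    · rw [max_eq_right h3] at h1
      linarith [le_max_right 0 (G (r + 1)), le_max_right 0 (G r - G (r + 1))]

end StoppedMin

/-- The discounted wealth at time `r` of the plan `C` in excess of that of the plan `C'`. -/
def wealthGap (R : ℕ → Ω → ℝ) (t : ℕ) (C C' : ℕ → Ω → ℝ) (r : ℕ) (ω : Ω) : ℝ :=
  ∑ j ∈ Finset.Ico t r, (C' j ω - C j ω) / cumProd R t j ω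

theorem wealthGap_self (C C' : ℕ → Ω → ℝ) (ω : Ω) : wealthGap R t C C' t ω = 0 := by
  simp [wealthGap]

theorem wealthGap_succ (C C' : ℕ → Ω → ℝ) {r : ℕ} (h : t ≤ r) (ω : Ω) :
    wealthGap R t C C' (r + 1) ω =
      wealthGap R t C C' r ω + (C' r ω - C r ω) / cumProd R t r ω :=
  Finset.sum_Ico_succ_top h _

theorem measurable_wealthGap_succ (E : IsEnvironment P ℱ T β R Y) {C C' : ℕ → Ω → ℝ}
    (hC : ∀ s, t ≤ s → s ≤ T → Measurable[ℱ s] (C s))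
    (hC' : ∀ s, t ≤ s → s ≤ T → Measurable[ℱ s] (C' s)) {r : ℕ} (hr : r ≤ T) :
    Measurable[ℱ r] (wealthGap R t C C' (r + 1)) := by
  refine Finset.measurable_fun_sum _ fun j hj => ?_
  rw [Finset.mem_Ico] at hj
  exact (((hC' j hj.1 (by omega)).sub (hC j hj.1 (by omega))).div
    (measurable_cumProd E.R_meas t (by omega))).mono (ℱ.mono (by omega)) le_rfl

theorem wealth_eq_sub_wealthGap (C C' : ℕ → Ω → ℝ) (w : ℝ) {ω : Ω}
    (hR : ∀ s ≤ T, 0 < cumProd R t s ω) {k : ℕ} (hk : t + k ≤ T) :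
    wealth R Y C' t w k ω =
      wealth R Y C t w k ω - cumProd R t (t + k) ω * wealthGap R t C C' (t + k) ω := by
  induction k with
  | zero => simp [wealth, wealthGap_self]
  | succ k ih =>
    have h := cumProd_succ R (Nat.le_add_right t k) ω
    have h0 := (hR (t + k) (by omega)).ne'
    simp only [wealth, ih (by omega)]
    rw [← add_assoc t k 1, h, wealthGap_succ C C' (Nat.le_add_right t k)]
    field_simp
    ring

/-- Moving wealth at most the fraction η of the way to another nonnegative wealth keeps it
nonnegative. -/
theorem mul_le_of_le_max {ρ X g ν η : ℝ} (hρ : 0 < ρ) (hX : 0 ≤ X) (hg : ρ * g ≤ X) (hη : 0 < η)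
    (hη1 : η < 1) (hν : ν ≤ max 0 (η * g)) : ρ * ν ≤ X := by
  rcases le_total g 0 with h | h
  · rw [max_eq_left (mul_nonpos_of_nonneg_of_nonpos hη.le h)] at hν
    linarith [mul_nonpos_of_nonneg_of_nonpos hρ.le hν]
  · rw [max_eq_right (mul_nonneg hη.le h)] at hν
    have h1 := mul_le_mul_of_nonneg_left hν hρ.le
    have h2 := mul_le_mul_of_nonneg_right hη1.le (mul_nonneg hρ.le h)
    linarith

/-- Where an optimal plan is strictly richer after consuming than another feasible plan, it is not
constrained and saving a little less is not profitable. -/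
theorem IsOptimalPlan.setLIntegral_marginalValue_le_succ [IsFiniteMeasure P]
    (E : IsEnvironment P ℱ T β R Y) (hA : 0 < A) (hγ : 0 < γ)
    (hu : ∀ x, 0 < x → HasDerivAt (felicity u) (A * x ^ (-γ)) x)
    (ht : t ≤ T) {w : ℝ} {C C' : ℕ → Ω → ℝ} (hC : IsOptimalPlan u P ℱ T β R Y t w C)
    (hC' : IsFeasiblePlan P ℱ T R Y t w C') {s : ℕ} (hs : t ≤ s) {S : Set Ω}
    (hS : MeasurableSet[ℱ s] S) (hSpos : ∀ ω ∈ S, 0 < wealthGap R t C C' (s + 1) ω) :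
    ∫⁻ ω in S, marginalValue γ β R T t C s ω ∂P ≤
      ∫⁻ ω in S, marginalValue γ β R T t C (s + 1) ω ∂P := by
  rcases Nat.lt_or_ge T s with hsT | hsT
  · simp [marginalValue_of_lt hsT]
  have hC0 : ∀ᵐ ω ∂P, ∀ s, t ≤ s → s ≤ T → 0 < C s ω := by
    simpa only [ae_all_iff] using hC.feasible.pos
  have hC'0 : ∀ᵐ ω ∂P, ∀ s, t ≤ s → s ≤ T → 0 < C' s ω := by
    simpa only [ae_all_iff] using hC'.pos
  have hR := ae_cumProd_pos E.R_pos t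
  refine le_of_forall_rpow_mul_le γ fun η hη hη1 => ?_
  set G : Ω → ℕ → ℝ := fun ω r => η * wealthGap R t C C' r ω with hG
  have hGm : ∀ r, r ≤ T → Measurable[ℱ r] fun ω => G ω (r + 1) := fun r hr =>
    (measurable_wealthGap_succ E hC.feasible.adapted hC'.adapted hr).const_mul η
  -- The bound G ≥ 1/(n + 1) lets the initial extra consumption ε fit below the gap.
  set B : ℕ → Set Ω := fun n =>
    S ∩ ({ω | (1 : ℝ) ≤ (n + 1) * G ω (s + 1)} ∩ interiorEvent γ η β R T t C s n) with hB
  have hBm : ∀ n, MeasurableSet[ℱ s] (B n) := fun n => MeasurableSet.inter hS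
    (MeasurableSet.inter (measurableSet_le measurable_const (Measurable.const_mul (hGm s hsT) _))
      (measurableSet_interiorEvent E hC.feasible.adapted hs hsT n))
  have hBmono : Monotone B := by
    rintro n k hnk ω ⟨h1, h2, h3⟩
    refine ⟨h1, ?_, monotone_interiorEvent hη hnk h3⟩
    have hnk' : (n : ℝ) ≤ k := by exact_mod_cast hnk
    have : 0 < G ω (s + 1) := mul_pos hη (hSpos ω h1)
    simp only [mem_ofPred_eq] at h2 ⊢
    exact h2.trans (by gcongr)
  refine setLIntegral_le_of_exhaustion hBmono ?_ fun n => ?_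
  · filter_upwards [hC0] with ω hω hωS
    obtain ⟨n₁, h₁⟩ := exists_mem_interiorEvent (γ := γ) (β := β) (R := R) (t := t) (T := T) hη
      (hω s hs hsT)
    have hGpos : 0 < G ω (s + 1) := mul_pos hη (hSpos ω hωS)
    obtain ⟨n₂, h₂⟩ := exists_nat_forall_le_mul (x := 1) hGpos
    refine ⟨max n₁ n₂, hωS, ?_, monotone_interiorEvent hη (le_max_left _ _) h₁⟩
    simp only [mem_ofPred_eq]
    exact h₂.trans (by gcongr; exact le_max_right _ _)
  set ε : ℝ := 1 / ((n : ℝ) + 1) with hε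
  have hn : (0 : ℝ) < (n : ℝ) + 1 := by positivity
  have hε0 : 0 < ε := by positivity
  have hscale : ∀ ω, ω ∈ B n → cumProd R t s ω * ε ≤ η * C s ω := by
    intro ω hω
    have h1 : cumProd R t s ω ≤ (n + 1) * (η * C s ω) := hω.2.2.2.1
    rw [hε, mul_one_div, div_le_iff₀ hn]
    linarith
  set I : Ω → ℝ := (B n).indicator (fun _ => ε) with hI
  have hI0 : ∀ ω, 0 ≤ I ω := fun ω => by
    by_cases hω : ω ∈ B n
    · simp only [hI, indicator_of_mem hω]; exact hε0.le
    · simp only [hI, indicator_of_notMem hω]; exact le_rfl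
  have hIG : ∀ ω, I ω ≤ max 0 (G ω (s + 1)) := fun ω => by
    by_cases hω : ω ∈ B n
    · refine le_max_of_le_right ?_
      simp only [hI, indicator_of_mem hω]
      have : (1 : ℝ) ≤ (n + 1) * G ω (s + 1) := hω.2.1
      rw [hε, div_le_iff₀ hn]
      linarith
    · simp only [hI, indicator_of_notMem hω]; exact le_max_left _ _
  have hIm : Measurable[ℱ s] I := Measurable.indicator measurable_const (hBm n)
  -- Consume ε more at time s on B, then cut consumption just enough to keep ν below the positive
  -- part of G.
  set ν : ℕ → Ω → ℝ := fun r ω => stoppedMin s (I ω) (G ω) r with hν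
  have hν0 : ∀ r ω, 0 ≤ ν r ω := fun r ω => stoppedMin_nonneg (hI0 ω) r
  have hν_le : ∀ r, r ≤ s → ∀ ω, ν r ω = 0 := fun r hr ω => stoppedMin_of_le hr
  have hν_start : ∀ ω, ν (s + 1) ω = I ω := fun ω => stoppedMin_start
  have hνm : ∀ r, r ≤ T → Measurable[ℱ r] (ν (r + 1)) := by
    intro r
    induction r with
    | zero =>
      intro hr
      rcases Nat.eq_zero_or_pos s with rfl | h
      · rw [funext hν_start]; exact hIm
      · rw [funext (hν_le (0 + 1) (by omega))]; exact measurable_const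
    | succ r ih =>
      intro hr
      rcases lt_trichotomy (r + 1) s with h | h | h
      · rw [funext (hν_le (r + 1 + 1) (by omega))]; exact measurable_const
      · rw [h, funext hν_start]; exact hIm
      · have h1 : ν (r + 1 + 1) = fun ω => max 0 (min (ν (r + 1) ω) (G ω (r + 1 + 1))) :=
          funext fun ω => stoppedMin_succ h
        rw [h1]
        exact Measurable.max measurable_const
          (Measurable.min ((ih (by omega)).mono (ℱ.mono (Nat.le_succ r)) le_rfl) (hGm _ hr))
  have hmvM : ∀ r, t ≤ r → Measurable (marginalValue γ β R T t C r) := fun r hr =>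
    (measurable_marginalValue E hC.feasible.adapted hr).mono (ℱ.le r) le_rfl
  have hBM : MeasurableSet (B n) := (ℱ.le s) _ (hBm n)
  have hloss : ∑ r ∈ Finset.Icc t T,
      ∫⁻ ω, marginalValue γ β R T t C r ω * ENNReal.ofReal (ν r ω - ν (r + 1) ω) ∂P ≤
      ENNReal.ofReal ε * ∫⁻ ω in B n, marginalValue γ β R T t C (s + 1) ω ∂P := by
    -- Losses so far plus the marginal value of the part of ν still open do not increase in r: this
    -- is the supermartingale property weighted by ν_{r+1}, known at time r.
    have hind : ∀ r, s + 1 ≤ r → r ≤ T + 1 → ∑ i ∈ Finset.Ico t r,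
        ∫⁻ ω, marginalValue γ β R T t C i ω * ENNReal.ofReal (ν i ω - ν (i + 1) ω) ∂P +
        ∫⁻ ω, marginalValue γ β R T t C r ω * ENNReal.ofReal (ν r ω) ∂P ≤
        ENNReal.ofReal ε * ∫⁻ ω in B n, marginalValue γ β R T t C (s + 1) ω ∂P := by
      intro r hr
      induction r, hr using Nat.le_induction with
      | base =>
        intro _
        rw [← lintegral_mul_indicator hBM, Finset.sum_eq_zero, zero_add]
        · simp only [hν_start]
          exact le_rfl
        · intro i hi
          rw [Finset.mem_Ico] at hi
          refine (lintegral_congr fun ω => ?_).trans lintegral_zero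
          rw [hν_le i (by omega), ENNReal.ofReal_of_nonpos (by linarith [hν0 (i + 1) ω]), mul_zero]
      | succ r hr ih =>
        intro hrT
        refine le_trans ?_ (ih (by omega))
        rw [Finset.sum_Ico_succ_top (by omega), add_assoc]
        refine add_le_add le_rfl ?_
        have h1 := hC.lintegral_marginalValue_succ_mul_le E hA hγ hu ht (s := r) (by omega)
          (hνm r (by omega)).ennreal_ofReal
        refine (add_le_add le_rfl h1).trans ?_
        rw [← lintegral_add_right]
        · refine lintegral_mono fun ω => ?_
          have h2 : 0 ≤ ν r ω - ν (r + 1) ω := by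
            linarith [stoppedMin_succ_le (G := G ω) (hI0 ω) (show s < r by omega)]
          simp only
          rw [← mul_add, ← ENNReal.ofReal_add h2 (hν0 _ _), sub_add_cancel]
        · exact (hmvM r (by omega)).mul
            (((hνm r (by omega)).mono (ℱ.le r) le_rfl).ennreal_ofReal)
    have h1 := hind (T + 1) (by omega) le_rfl
    have h2 : Finset.Icc t T = Finset.Ico t (T + 1) := by ext; simp
    rw [h2]
    exact le_self_add.trans h1
  have hfin : ∫⁻ ω in B n, marginalValue γ β R T t C (s + 1) ω ∂P < ∞ :=
    (hC.setLIntegral_marginalValue_succ_le E hA hγ hu ht hs (hBm n)).trans_lt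
      (setLIntegral_interiorEvent_lt_top hBM fun ω hω => hω.2.2)
  have hlt : ENNReal.ofReal ε * ∫⁻ ω in B n, marginalValue γ β R T t C (s + 1) ω ∂P ≠ ∞ :=
    ENNReal.mul_ne_top ENNReal.ofReal_ne_top hfin.ne
  have hνG : ∀ r ω, ν r ω ≤ max 0 (η * wealthGap R t C C' r ω) := fun r ω =>
    stoppedMin_le (hIG ω) r
  have key := hC.lintegral_gain_le_loss E hA hγ hu ht hη hη1 (ν := ν) (hν_le t hs)
    (fun r _ hrT => hνm r hrT)
    (by
      filter_upwards [hC0, hC'0, hR] with ω h1 h1' h2 r hr hrT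
      have hcr := mul_pos hη (h1 r hr hrT)
      have hρ := h2 r hrT
      rcases Nat.lt_or_ge s r with h | h
      · have h3 := stoppedMin_sub_succ_le (hI0 ω) (hIG ω) h
        have h4 : cumProd R t r ω * (G ω r - G ω (r + 1)) ≤ η * C r ω := by
          have h5 : cumProd R t r ω * (G ω r - G ω (r + 1)) = η * (C r ω - C' r ω) := by
            simp only [hG, wealthGap_succ C C' hr]
            field_simp
            ring
          rw [h5]
          exact mul_le_mul_of_nonneg_left (by linarith [h1' r hr hrT]) hη.le
        have h6 : cumProd R t r ω * max 0 (G ω r - G ω (r + 1)) ≤ η * C r ω := by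
          rcases max_choice 0 (G ω r - G ω (r + 1)) with h | h
          · rw [h, mul_zero]; exact hcr.le
          · rw [h]; exact h4
        have h7 := mul_le_mul_of_nonneg_left h3 hρ.le
        simp only [hν]
        linarith
      · have h3 := mul_nonneg hρ.le (hν0 (r + 1) ω)
        rw [hν_le r h, sub_zero]
        linarith)
    (by
      have hW : ∀ᵐ ω ∂P, ∀ k, t + k + 1 ≤ T → 0 ≤ wealth R Y C t w (k + 1) ω := by
        simpa only [ae_all_iff] using hC.feasible.wealth_nonneg
      have hW' : ∀ᵐ ω ∂P, ∀ k, t + k + 1 ≤ T → 0 ≤ wealth R Y C' t w (k + 1) ω := by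
        simpa only [ae_all_iff] using hC'.wealth_nonneg
      filter_upwards [hW, hW', hR] with ω h1 h1' h2 k hk
      have h3 := h1' k hk
      rw [wealth_eq_sub_wealthGap C C' w h2 (by omega)] at h3
      exact mul_le_of_le_max (h2 _ hk) (h1 k hk) (sub_nonneg.1 h3) hη hη1 (hνG _ ω))
    (by
      filter_upwards [hC.feasible.terminal, hC'.terminal, hR] with ω h1 h1' h2
      rw [wealth_eq_sub_wealthGap C C' w h2 (by omega), Nat.add_sub_cancel' ht] at h1'
      -- Index T + 1 of the gap compares what the two plans leave unspent at the horizon.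
      have h3 : cumProd R t T ω * wealthGap R t C C' (T + 1) ω ≤
          wealth R Y C t w (T - t) ω - C T ω := by
        have h4 := (h2 T le_rfl).ne'
        rw [wealthGap_succ C C' ht, mul_add, mul_div_cancel₀ _ h4]
        linarith
      have := mul_le_of_le_max (h2 T le_rfl) (sub_nonneg.2 h1) h3 hη hη1 (hνG _ ω)
      linarith)
    (ne_top_of_le_ne_top hlt hloss) hs hsT hBM
    (Eventually.of_forall fun ω hω => by
      rw [hν_start, hν_le s le_rfl, sub_zero]
      simp only [hI, indicator_of_mem hω]
      exact hscale ω hω)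
  simp only [hν_start, hν_le s le_rfl, sub_zero] at key
  rw [setLIntegral_mul_indicator le_rfl hBM] at key
  have hεne : ENNReal.ofReal ε ≠ 0 := by simpa using hε0
  have key2 := key.trans (mul_le_mul_right hloss _)
  rw [mul_left_comm, mul_left_comm (ENNReal.ofReal ((1 - η) ^ (-γ))),
    ENNReal.mul_le_mul_iff_right hεne ENNReal.ofReal_ne_top] at key2
  exact key2.trans (mul_le_mul_right (lintegral_mono_set inter_subset_left) _)

end EulerEquality

/-! ### Concavity of the consumption function -/

section Concavity

open scoped ENNReal

variable {Ω : Type*} {m : MeasurableSpace Ω} {P : Measure Ω} {ℱ : Filtration ℕ m}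
  {T t : ℕ} {β R Y : ℕ → Ω → ℝ} {u : ℝ → EReal} {A γ : ℝ}

/-- The tangent bounds for -z^(-γ) at the mean are averaged with weights a and b; the linear terms
cancel. -/
theorem rpow_neg_convex {γ a b x y : ℝ} (hγ : 0 < γ) (ha : 0 ≤ a) (hb : 0 ≤ b) (hab : a + b = 1)
    (hx : 0 < x) (hy : 0 < y) : (a * x + b * y) ^ (-γ) ≤ a * x ^ (-γ) + b * y ^ (-γ) := by
  have hz : 0 < a * x + b * y := by
    have := convex_Ioi (0 : ℝ) (mem_Ioi.2 hx) (mem_Ioi.2 hy) ha hb hab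
    simpa using this
  have hd : ∀ z : ℝ, 0 < z → HasDerivAt (fun z => -(z ^ (-γ))) (γ * z ^ (-γ - 1)) z := by
    intro z hz
    refine (Real.hasDerivAt_rpow_const (p := -γ) (Or.inl hz.ne')).neg.congr_deriv ?_
    ring
  have hanti : AntitoneOn (fun z : ℝ => γ * z ^ (-γ - 1)) (Ioi 0) := fun p hp q _ hpq =>
    mul_le_mul_of_nonneg_left (Real.rpow_le_rpow_of_nonpos hp hpq (by linarith)) hγ.le
  have h1 := mul_le_mul_of_nonneg_left (le_tangent_of_antitoneOn_deriv hd hanti hz hx) ha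
  have h2 := mul_le_mul_of_nonneg_left (le_tangent_of_antitoneOn_deriv hd hanti hz hy) hb
  have hb' : b = 1 - a := by linarith
  subst hb'
  linarith

/-- The reciprocal power mean is concave: weights for which marginal utility at a convex
combination is controlled by the marginal utilities of its components. -/
theorem rpow_neg_combination_le {γ a b c₀ c₁ x₀ x₁ : ℝ} (hγ : 0 < γ) (ha : 0 < a) (hb : 0 < b)
    (hc₀ : 0 < c₀) (hc₁ : 0 < c₁) (hx₀ : 0 < x₀) (hx₁ : 0 < x₁) :
    (a * x₀ + b * x₁) ^ (-γ) ≤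
      x₀ ^ (-γ) * ((a * c₀ + b * c₁) ^ (-γ) * (a * c₀ / (a * c₀ + b * c₁)) * c₀ ^ γ) +
      x₁ ^ (-γ) * ((a * c₀ + b * c₁) ^ (-γ) * (b * c₁ / (a * c₀ + b * c₁)) * c₁ ^ γ) := by
  have hc : 0 < a * c₀ + b * c₁ := by positivity
  -- Convexity is applied to the growth ratios x_i / c_i, with weights the shares of the two plans
  -- in mixed consumption today.
  have h := rpow_neg_convex hγ (a := a * c₀ / (a * c₀ + b * c₁)) (b := b * c₁ / (a * c₀ + b * c₁))
    (by positivity) (by positivity) (by field_simp) (div_pos hx₀ hc₀) (div_pos hx₁ hc₁)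
  have e : a * x₀ + b * x₁ = (a * c₀ + b * c₁) * (a * c₀ / (a * c₀ + b * c₁) * (x₀ / c₀) +
      b * c₁ / (a * c₀ + b * c₁) * (x₁ / c₁)) := by field_simp
  have hcp : 0 ≤ (a * c₀ + b * c₁) ^ (-γ) := Real.rpow_nonneg hc.le _
  rw [e, Real.mul_rpow hc.le (by positivity)]
  have h' := mul_le_mul_of_nonneg_left h hcp
  rw [Real.div_rpow hx₀.le hc₀.le, Real.div_rpow hx₁.le hc₁.le, Real.rpow_neg hc₀.le,
    Real.rpow_neg hc₁.le, div_inv_eq_mul, div_inv_eq_mul] at h'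
  refine h'.trans (le_of_eq ?_)
  ring

/-- Convex combination of two plans. -/
def mixPlan (a b : ℝ) (C₀ C₁ : ℕ → Ω → ℝ) (s : ℕ) (ω : Ω) : ℝ := a * C₀ s ω + b * C₁ s ω

theorem wealth_mixPlan {a b : ℝ} (hab : a + b = 1) (C₀ C₁ : ℕ → Ω → ℝ) (w₀ w₁ : ℝ) (k : ℕ)
    (ω : Ω) : wealth R Y (mixPlan a b C₀ C₁) t (a * w₀ + b * w₁) k ω =
      a * wealth R Y C₀ t w₀ k ω + b * wealth R Y C₁ t w₁ k ω := by
  induction k with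
  | zero => rfl
  | succ k ih =>
    simp only [wealth, ih, mixPlan]
    linear_combination (-(Y (t + k + 1) ω)) * hab

theorem IsFeasiblePlan.mix {a b : ℝ} (ha : 0 < a) (hb : 0 < b) (hab : a + b = 1) {w₀ w₁ : ℝ}
    {C₀ C₁ : ℕ → Ω → ℝ} (h₀ : IsFeasiblePlan P ℱ T R Y t w₀ C₀)
    (h₁ : IsFeasiblePlan P ℱ T R Y t w₁ C₁) :
    IsFeasiblePlan P ℱ T R Y t (a * w₀ + b * w₁) (mixPlan a b C₀ C₁) where
  adapted s hs hsT := ((h₀.adapted s hs hsT).const_mul a).add ((h₁.adapted s hs hsT).const_mul b)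
  pos s hs hsT := by
    filter_upwards [h₀.pos s hs hsT, h₁.pos s hs hsT] with ω k₀ k₁
    exact add_pos (mul_pos ha k₀) (mul_pos hb k₁)
  wealth_nonneg k hk := by
    filter_upwards [h₀.wealth_nonneg k hk, h₁.wealth_nonneg k hk] with ω k₀ k₁
    rw [wealth_mixPlan hab]
    positivity
  terminal := by
    filter_upwards [h₀.terminal, h₁.terminal] with ω k₀ k₁
    rw [wealth_mixPlan hab]
    exact add_le_add (mul_le_mul_of_nonneg_left k₀ ha.le) (mul_le_mul_of_nonneg_left k₁ hb.le)

/-- With power marginal utility, the supermartingale property of discounted marginal utility is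
inherited by convex combinations of optimal plans. -/
theorem setLIntegral_marginalValue_mixPlan_succ_le [IsFiniteMeasure P]
    (E : IsEnvironment P ℱ T β R Y) (hA : 0 < A) (hγ : 0 < γ)
    (hu : ∀ x, 0 < x → HasDerivAt (felicity u) (A * x ^ (-γ)) x)
    (ht : t ≤ T) {w₀ w₁ : ℝ} {C₀ C₁ : ℕ → Ω → ℝ} (h₀ : IsOptimalPlan u P ℱ T β R Y t w₀ C₀)
    (h₁ : IsOptimalPlan u P ℱ T β R Y t w₁ C₁) {a b : ℝ} (ha : 0 < a) (hb : 0 < b)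
    {s : ℕ} (hs : t ≤ s) {S : Set Ω} (hS : MeasurableSet[ℱ s] S) :
    ∫⁻ ω in S, marginalValue γ β R T t (mixPlan a b C₀ C₁) (s + 1) ω ∂P ≤
      ∫⁻ ω in S, marginalValue γ β R T t (mixPlan a b C₀ C₁) s ω ∂P := by
  rcases Nat.lt_or_ge T (s + 1) with hsT | hsT
  · simp [marginalValue_of_lt hsT]
  have hsT' : s ≤ T := by omega
  have hβ := ae_cumProd_pos E.β_pos t
  have hR := ae_cumProd_pos E.R_pos t
  have hSM : MeasurableSet S := (ℱ.le s) _ hS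
  -- These multipliers are known at time s. They dominate the mixed marginal value at s + 1 and
  -- reproduce it exactly at s.
  set f₀ : Ω → ℝ := fun ω => (a * C₀ s ω + b * C₁ s ω) ^ (-γ) *
    (a * C₀ s ω / (a * C₀ s ω + b * C₁ s ω)) * C₀ s ω ^ γ with hf₀
  set f₁ : Ω → ℝ := fun ω => (a * C₀ s ω + b * C₁ s ω) ^ (-γ) *
    (b * C₁ s ω / (a * C₀ s ω + b * C₁ s ω)) * C₁ s ω ^ γ with hf₁
  have m₀ : Measurable[ℱ s] fun ω => a * C₀ s ω :=
    (h₀.feasible.adapted s hs hsT').const_mul a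
  have m₁ : Measurable[ℱ s] fun ω => b * C₁ s ω :=
    (h₁.feasible.adapted s hs hsT').const_mul b
  have mf₀ : Measurable[ℱ s] f₀ := (((m₀.add m₁).pow_const _).mul (m₀.div (m₀.add m₁))).mul
    ((h₀.feasible.adapted s hs hsT').pow_const _)
  have mf₁ : Measurable[ℱ s] f₁ := (((m₀.add m₁).pow_const _).mul (m₁.div (m₀.add m₁))).mul
    ((h₁.feasible.adapted s hs hsT').pow_const _)
  have mI₀ : Measurable[ℱ s] (S.indicator fun ω => ENNReal.ofReal (f₀ ω)) :=
    Measurable.indicator mf₀.ennreal_ofReal hS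
  have mI₁ : Measurable[ℱ s] (S.indicator fun ω => ENNReal.ofReal (f₁ ω)) :=
    Measurable.indicator mf₁.ennreal_ofReal hS
  have e₀ := h₀.lintegral_marginalValue_succ_mul_le E hA hγ hu ht hs mI₀
  have e₁ := h₁.lintegral_marginalValue_succ_mul_le E hA hγ hu ht hs mI₁
  have hmM : ∀ {C : ℕ → Ω → ℝ} {w : ℝ}, IsOptimalPlan u P ℱ T β R Y t w C → ∀ r, t ≤ r →
      Measurable (marginalValue γ β R T t C r) := fun hC r hr =>
    (measurable_marginalValue E hC.feasible.adapted hr).mono (ℱ.le r) le_rfl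
  have mI₀' := mI₀.mono (ℱ.le s) le_rfl
  have hpos : ∀ᵐ ω ∂P, 0 < C₀ s ω ∧ 0 < C₁ s ω ∧ 0 < C₀ (s + 1) ω ∧ 0 < C₁ (s + 1) ω := by
    filter_upwards [h₀.feasible.pos s hs hsT', h₁.feasible.pos s hs hsT',
      h₀.feasible.pos (s + 1) (by omega) hsT, h₁.feasible.pos (s + 1) (by omega) hsT]
      with ω k₁ k₂ k₃ k₄ using ⟨k₁, k₂, k₃, k₄⟩
  rw [← lintegral_indicator hSM, ← lintegral_indicator hSM]
  calc ∫⁻ ω, S.indicator (marginalValue γ β R T t (mixPlan a b C₀ C₁) (s + 1)) ω ∂P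
      ≤ ∫⁻ ω, (marginalValue γ β R T t C₀ (s + 1) ω * S.indicator (fun ω => ENNReal.ofReal (f₀ ω)) ω
        + marginalValue γ β R T t C₁ (s + 1) ω *
          S.indicator (fun ω => ENNReal.ofReal (f₁ ω)) ω) ∂P := by
        refine lintegral_mono_ae ?_
        filter_upwards [hβ, hR, hpos] with ω k₁ k₂ k₃
        by_cases hω : ω ∈ S
        · simp only [indicator_of_mem hω, marginalValue_of_le hsT]
          obtain ⟨p₁, p₂, p₃, p₄⟩ := k₃
          have q := mul_pos (k₁ (s + 1) hsT) (k₂ (s + 1) hsT)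
          have r₀ : 0 ≤ f₀ ω := by simp only [hf₀]; positivity
          have r₁ : 0 ≤ f₁ ω := by simp only [hf₁]; positivity
          rw [← ENNReal.ofReal_mul (by positivity), ← ENNReal.ofReal_mul (by positivity),
            ← ENNReal.ofReal_add (by positivity) (by positivity)]
          refine ENNReal.ofReal_le_ofReal ?_
          have := mul_le_mul_of_nonneg_left
            (rpow_neg_combination_le hγ ha hb p₁ p₂ p₃ p₄) q.le
          simp only [mixPlan, hf₀, hf₁]
          linarith
        · simp only [indicator_of_notMem hω]
          exact zero_le
    _ = ∫⁻ ω, marginalValue γ β R T t C₀ (s + 1) ω *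
          S.indicator (fun ω => ENNReal.ofReal (f₀ ω)) ω ∂P +
        ∫⁻ ω, marginalValue γ β R T t C₁ (s + 1) ω *
          S.indicator (fun ω => ENNReal.ofReal (f₁ ω)) ω ∂P :=
        lintegral_add_left ((hmM h₀ (s + 1) (by omega)).mul mI₀') _
    _ ≤ ∫⁻ ω, marginalValue γ β R T t C₀ s ω *
          S.indicator (fun ω => ENNReal.ofReal (f₀ ω)) ω ∂P +
        ∫⁻ ω, marginalValue γ β R T t C₁ s ω *
          S.indicator (fun ω => ENNReal.ofReal (f₁ ω)) ω ∂P := add_le_add e₀ e₁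
    _ = ∫⁻ ω, (marginalValue γ β R T t C₀ s ω * S.indicator (fun ω => ENNReal.ofReal (f₀ ω)) ω
        + marginalValue γ β R T t C₁ s ω *
          S.indicator (fun ω => ENNReal.ofReal (f₁ ω)) ω) ∂P :=
        (lintegral_add_left ((hmM h₀ s hs).mul mI₀') _).symm
    _ = ∫⁻ ω, S.indicator (marginalValue γ β R T t (mixPlan a b C₀ C₁) s) ω ∂P := by
        refine lintegral_congr_ae ?_
        filter_upwards [hβ, hR, hpos] with ω k₁ k₂ k₃
        by_cases hω : ω ∈ S
        · simp only [indicator_of_mem hω, marginalValue_of_le hsT']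
          obtain ⟨p₁, p₂, p₃, p₄⟩ := k₃
          have q := mul_pos (k₁ s hsT') (k₂ s hsT')
          have r₀ : 0 ≤ f₀ ω := by simp only [hf₀]; positivity
          have r₁ : 0 ≤ f₁ ω := by simp only [hf₁]; positivity
          rw [← ENNReal.ofReal_mul (by positivity), ← ENNReal.ofReal_mul (by positivity),
            ← ENNReal.ofReal_add (by positivity) (by positivity)]
          congr 1
          have hc : a * C₀ s ω + b * C₁ s ω ≠ 0 := by positivity
          have g₀ : C₀ s ω ^ (-γ) * C₀ s ω ^ γ = 1 := by
            rw [← Real.rpow_add p₁]; simp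
          have g₁ : C₁ s ω ^ (-γ) * C₁ s ω ^ γ = 1 := by
            rw [← Real.rpow_add p₂]; simp
          have hsum : a * C₀ s ω / (a * C₀ s ω + b * C₁ s ω) +
              b * C₁ s ω / (a * C₀ s ω + b * C₁ s ω) = 1 := by
            rw [← add_div, div_self hc]
          simp only [mixPlan, hf₀, hf₁]
          set z := (a * C₀ s ω + b * C₁ s ω) ^ (-γ)
          set l₀ := a * C₀ s ω / (a * C₀ s ω + b * C₁ s ω)
          set l₁ := b * C₁ s ω / (a * C₀ s ω + b * C₁ s ω)
          set d := cumProd β t s ω * cumProd R t s ω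
          linear_combination (d * z * l₀) * g₀ + (d * z * l₁) * g₁ + (d * z) * hsum
        · simp only [indicator_of_notMem hω, mul_zero, add_zero]

theorem ae_le_of_forall_setLIntegral_le {𝒢 m : MeasurableSpace Ω} {P : Measure[m] Ω}
    [IsFiniteMeasure P] (h𝒢 : 𝒢 ≤ m) {X Z : Ω → ℝ≥0∞} (hX : Measurable[𝒢] X)
    (hZ : Measurable[𝒢] Z) {S : Set Ω} (hS : MeasurableSet[𝒢] S)
    (h : ∀ A, MeasurableSet[𝒢] A → A ⊆ S → ∫⁻ ω in A, X ω ∂P ≤ ∫⁻ ω in A, Z ω ∂P) :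
    ∀ᵐ ω ∂P, ω ∈ S → X ω ≤ Z ω := by
  have mX : Measurable[𝒢] (S.indicator X) := Measurable.indicator hX hS
  have mZ : Measurable[𝒢] (S.indicator Z) := Measurable.indicator hZ hS
  have h1 : S.indicator X ≤ᵐ[P.trim h𝒢] S.indicator Z := by
    refine ae_le_of_forall_setLIntegral_le_of_sigmaFinite mX fun B hB _ => ?_
    rw [restrict_trim h𝒢 P hB, lintegral_trim h𝒢 mX, lintegral_trim h𝒢 mZ,
      setLIntegral_indicator (h𝒢 _ hS), setLIntegral_indicator (h𝒢 _ hS)]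
    exact h _ (MeasurableSet.inter hS hB) inter_subset_left
  filter_upwards [ae_le_of_ae_le_trim h1] with ω hω hωS
  rwa [indicator_of_mem hωS, indicator_of_mem hωS] at hω

/-- An optimal plan from a convex combination of initial wealths consumes at least the convex
combination of optimal plans, as long as it is not poorer. -/
theorem IsOptimalPlan.mixPlan_le [IsFiniteMeasure P]
    (E : IsEnvironment P ℱ T β R Y) (hA : 0 < A) (hγ : 0 < γ)
    (hu : ∀ x, 0 < x → HasDerivAt (felicity u) (A * x ^ (-γ)) x)
    (ht : t ≤ T) {w₀ w₁ : ℝ} {C₀ C₁ C : ℕ → Ω → ℝ} (h₀ : IsOptimalPlan u P ℱ T β R Y t w₀ C₀)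
    (h₁ : IsOptimalPlan u P ℱ T β R Y t w₁ C₁) {a b : ℝ} (ha : 0 < a) (hb : 0 < b)
    (hab : a + b = 1) (h : IsOptimalPlan u P ℱ T β R Y t (a * w₀ + b * w₁) C)
    {s : ℕ} (hs : t ≤ s) (hsT : s ≤ T) :
    ∀ᵐ ω ∂P, 0 ≤ wealthGap R t C (mixPlan a b C₀ C₁) s ω → mixPlan a b C₀ C₁ s ω ≤ C s ω := by
  have hmix := h₀.feasible.mix ha hb hab h₁.feasible
  set C' := mixPlan a b C₀ C₁ with hC'
  have hβ := ae_cumProd_pos E.β_pos t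
  have hR := ae_cumProd_pos E.R_pos t
  -- Backward induction on the time remaining, at most k.
  suffices H : ∀ k s, t ≤ s → s ≤ T → T ≤ s + k →
      ∀ᵐ ω ∂P, 0 ≤ wealthGap R t C C' s ω → C' s ω ≤ C s ω from H (T - s) s hs hsT (by omega)
  clear hs hsT
  have step : ∀ s, t ≤ s → s ≤ T →
      (s + 1 ≤ T → ∀ᵐ ω ∂P, 0 ≤ wealthGap R t C C' (s + 1) ω → C' (s + 1) ω ≤ C (s + 1) ω) →
      ∀ᵐ ω ∂P, 0 ≤ wealthGap R t C C' s ω → C' s ω ≤ C s ω := by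
    intro s hs hsT hnext
    set S : Set Ω := {ω | 0 < wealthGap R t C C' (s + 1) ω} with hSdef
    have hS : MeasurableSet[ℱ s] S := measurableSet_lt measurable_const
      (measurable_wealthGap_succ E h.feasible.adapted hmix.adapted hsT)
    have hmv : ∀ᵐ ω ∂P, ω ∈ S →
        marginalValue γ β R T t C (s + 1) ω ≤ marginalValue γ β R T t C' (s + 1) ω := by
      by_cases hsT1 : s + 1 ≤ T
      · filter_upwards [hnext hsT1, hβ, hR, hmix.pos (s + 1) (by omega) hsT1]
          with ω k₁ k₂ k₃ k₄ hωS
        have k₅ := k₁ (le_of_lt hωS)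
        rw [marginalValue_of_le hsT1, marginalValue_of_le hsT1]
        refine ENNReal.ofReal_le_ofReal (mul_le_mul_of_nonneg_left ?_
          (mul_pos (k₂ _ hsT1) (k₃ _ hsT1)).le)
        exact Real.rpow_le_rpow_of_nonpos k₄ k₅ (by linarith)
      -- At s = T both successor values vanish by definition; an optimal plan leaves nothing unspent
      -- there.
      · refine Eventually.of_forall fun ω _ => ?_
        rw [marginalValue_of_lt (by omega)]
        exact zero_le
    have hle := ae_le_of_forall_setLIntegral_le (P := P) (ℱ.le s)
      (measurable_marginalValue E (γ := γ) h.feasible.adapted hs)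
      (measurable_marginalValue E (γ := γ) hmix.adapted hs) hS fun B hB hBS => by
        calc ∫⁻ ω in B, marginalValue γ β R T t C s ω ∂P
            ≤ ∫⁻ ω in B, marginalValue γ β R T t C (s + 1) ω ∂P :=
              h.setLIntegral_marginalValue_le_succ E hA hγ hu ht hmix hs hB fun ω hω => hBS hω
          _ ≤ ∫⁻ ω in B, marginalValue γ β R T t C' (s + 1) ω ∂P := by
              refine setLIntegral_mono_ae' ((ℱ.le s) _ hB) ?_
              filter_upwards [hmv] with ω hω hωB using hω (hBS hωB)
          _ ≤ ∫⁻ ω in B, marginalValue γ β R T t C' s ω ∂P :=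
              setLIntegral_marginalValue_mixPlan_succ_le E hA hγ hu ht h₀ h₁ ha hb hs hB
    filter_upwards [hle, hβ, hR, h.feasible.pos s hs hsT, hmix.pos s hs hsT]
      with ω k₁ k₂ k₃ k₄ k₅ hgap
    by_cases hω : ω ∈ S
    · have k₆ := k₁ hω
      have hq := mul_pos (k₂ s hsT) (k₃ s hsT)
      rw [marginalValue_of_le hsT, marginalValue_of_le hsT,
        ENNReal.ofReal_le_ofReal_iff (mul_nonneg hq.le (Real.rpow_nonneg k₅.le _))] at k₆
      have k₇ := le_of_mul_le_mul_left k₆ hq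
      by_contra! hlt
      exact absurd k₇ (not_le.2 (Real.rpow_lt_rpow_of_neg k₄ hlt (by linarith)))
    -- If C is not strictly richer after consuming, the gap has gone from nonnegative to
    -- nonpositive, so C consumed at least as much as C'.
    · have k₆ : wealthGap R t C C' (s + 1) ω ≤ 0 := not_lt.1 hω
      rw [wealthGap_succ C C' hs] at k₆
      have k₇ : (C' s ω - C s ω) / cumProd R t s ω ≤ 0 := by linarith
      rw [div_le_iff₀ (k₃ s hsT), zero_mul] at k₇
      linarith
  intro k
  induction k with
  | zero => exact fun s hs hsT hk => step s hs hsT fun h => absurd h (by omega)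
  | succ k ih =>
    exact fun s hs hsT hk => step s hs hsT fun h => ih (s + 1) (by omega) h (by omega)

/-- With CRRA utility, consumption functions have concave versions. -/
theorem IsConsumptionFunction.hasConcaveVersion [IsFiniteMeasure P]
    (E : IsEnvironment P ℱ T β R Y) (hA : 0 < A) (hγ : 0 < γ)
    (hu : ∀ x, 0 < x → HasDerivAt (felicity u) (A * x ^ (-γ)) x)
    (ht : t ≤ T) {D : Set ℝ} (hD : Convex ℝ D) {c : ℝ → Ω → ℝ}
    (hc : IsConsumptionFunction u P ℱ T β R Y t D c) : HasConcaveVersion P D c := by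
  refine hasConcaveVersion_of_ae hD fun x hx y hy z hz hxy hyz => ?_
  obtain ⟨C₀, h₀, e₀⟩ := hc x hx
  obtain ⟨C₁, h₁, e₁⟩ := hc z hz
  obtain ⟨C, h, e⟩ := hc y hy
  have hzx : 0 < z - x := by linarith
  have ha : 0 < (z - y) / (z - x) := div_pos (by linarith) hzx
  have hb : 0 < (y - x) / (z - x) := div_pos (by linarith) hzx
  have hab : (z - y) / (z - x) + (y - x) / (z - x) = 1 := by field_simp; ring
  have hyw : y = (z - y) / (z - x) * x + (y - x) / (z - x) * z := by field_simp; ring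
  rw [hyw] at h
  filter_upwards [e₀, e₁, e, h₀.mixPlan_le E hA hγ hu ht h₁ ha hb hab h le_rfl ht]
    with ω k₀ k₁ k₂ k₃
  have k₄ := k₃ (wealthGap_self _ _ _).ge
  rw [mixPlan, k₀, k₁, k₂] at k₄
  have k₅ := mul_le_mul_of_nonneg_left k₄ hzx.le
  have k₆ : (z - x) * ((z - y) / (z - x) * c x ω + (y - x) / (z - x) * c z ω) =
      (z - y) * c x ω + (y - x) * c z ω := by field_simp
  linarith

end Concavity

end ConsumptionSaving

end

theorem theorem1 (u : ℝ → EReal) (hu : ConsumptionSaving.IsRegularUtility u) :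
    ((∀ (N : ℕ) (π β R Y : Fin N → ℝ), ConsumptionSaving.IsFiniteDistribution π β R Y →
        ∀ c : ℝ → ℝ, ConsumptionSaving.IsStaticConsumptionFunction u π β R Y c →
          ConcaveOn ℝ (Set.Ioi 0) c) →
      ConsumptionSaving.IsCRRA u) ∧
    (ConsumptionSaving.IsCRRA u →
      ∀ {Ω : Type*} {m : MeasurableSpace Ω} (P : MeasureTheory.Measure Ω)
        [MeasureTheory.IsProbabilityMeasure P] (ℱ : MeasureTheory.Filtration ℕ m) (T : ℕ)
        (β R Y : ℕ → Ω → ℝ), ConsumptionSaving.IsEnvironment P ℱ T β R Y →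
        ∀ t ≤ T, ∀ D ⊆ Set.Ici (0 : ℝ), Convex ℝ D →
          ∀ c : ℝ → Ω → ℝ, ConsumptionSaving.IsConsumptionFunction u P ℱ T β R Y t D c →
            ConsumptionSaving.HasConcaveVersion P D c) := by
  refine ⟨hu.isCRRA_of_concaveOn_consumption, ?_⟩
  rintro ⟨γ, hγ, A, hA, hderiv⟩ Ω m P _ ℱ T β R Y E t ht D _ hD c hc
  exact hc.hasConcaveVersion E hA hγ hderiv ht hD
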